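/- Let $k$ be a ring and let $X$ be a connected, locally simply connected topological space. Here a space is called simply connected if it is connected and every covering of it is trivial, and locally simply connected if every point has a basis of simply connected open neighbourhoods. Let $\phi\colon\widetilde X\to X$ be a universal covering (a covering with simply connected total space) and let $G=\operatorname{Aut}_X\widetilde X$. Let $\operatorname{Shv}_k(X)$ be the category of sheaves of $k$-modules on $X$, let $\operatorname{Mod}_k(G)$ be the category of $k$-modules with a $k$-linear action of $G$, and let $i\colon\operatorname{Qcoh}_k(X)\hookrightarrow\operatorname{Shv}_k(X)$ be the inclusion of the full subcategory of quasi-coherent sheaves, i.e. of those $F$ such that every point has an open neighbourhood $U$ with an exact sequence $k_U^{\oplus I}\to k_U^{\oplus J}\to F|_U\to 0$. For a $G$-module $E$ let $\mathcal L_E$ be the sheaf of sections of $(\widetilde X\times E)/G\to\widetilde X/G=X$, where $E$ is discrete and $G$ acts by $g(\tilde x,e)=(g\tilde x,ge)$, with the fibrewise $k$-module structure $[\tilde x,e]+[\tilde x,e']=[\tilde x,e+e']$, $c[\tilde x,e]=[\tilde x,ce]$. For a sheaf $F$ on $X$, let $G$ act on $\Gamma(\widetilde X,\phi^{-1}F)$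 through its action on $\phi^{-1}F$, i.e. $g\cdot s=s\circ g^{-1}$ for $s$ viewed as a continuous map from $\widetilde X$ to the étalé space of $F$ over $X$. Then every $\mathcal L_E$ is quasi-coherent, in fact locally constant, and $E\mapsto\mathcal L_E$ is an equivalence $\operatorname{Mod}_k(G)\to\operatorname{Qcoh}_k(X)$. The inclusion $i$ has a right adjoint, and for every right adjoint $\operatorname{Qc}\colon\operatorname{Shv}_k(X)\to\operatorname{Qcoh}_k(X)$ of $i$ (the quasi-coherator) there is an isomorphism, natural in $F\in\operatorname{Shv}_k(X)$, $$\operatorname{Qc}(F)\cong\mathcal L_{\Gamma(\widetilde X,\phi^{-1}F)} .$$ -/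

import Mathlib

open CategoryTheory Limits TopologicalSpace Topology Opposite

universe u

namespace QuasiCoherator

section Coverings

/-- A space is *simply connected* if it is connected (in particular non-empty) and every covering
of it is trivial, i.e. isomorphic over the space to a product with a discrete space. -/
structure IsSimplyConnected (X : Type u) [TopologicalSpace X] : Prop where
  connectedSpace : ConnectedSpace X
  exists_trivialization : ∀ (E : Type u) [TopologicalSpace E] (p : E → X), IsCoveringMap p →
    ∃ (I : Type u) (_ : TopologicalSpace I) (_ : DiscreteTopology I),
      IsHomeomorphicTrivialFiberBundle I p

/-- A space is *locally simply connected* if every point has a basis of simply connected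
open neighbourhoods. -/
def IsLocallySimplyConnected (X : Type u) [TopologicalSpace X] : Prop :=
  ∀ (x : X) (U : Set X), U ∈ 𝓝 x →
    ∃ V : Set X, V ⊆ U ∧ IsOpen V ∧ x ∈ V ∧ IsSimplyConnected V

/-- A *universal covering* is a covering map whose total space is simply connected. -/
class IsUniversalCovering {X Y : TopCat.{u}} (φ : Y ⟶ X) : Prop where
  isCoveringMap : IsCoveringMap φ
  isSimplyConnected : IsSimplyConnected Y

/-- The group `Aut_X Y` of automorphisms of `Y` over `X`. -/
def Deck {X Y : TopCat.{u}} (φ : Y ⟶ X) : Subgroup (Y ≃ₜ Y) where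
  carrier := {g | ∀ y, φ (g y) = φ y}
  mul_mem' {a b} ha hb y := (ha (b y)).trans (hb y)
  one_mem' _ := rfl
  inv_mem' {a} ha y := by
    have := ha (a.symm y)
    rw [a.apply_symm_apply] at this
    exact this.symm

/-- The first projection of the fibre product of two copies of a covering is a covering. -/
theorem isCoveringMap_fst {X Y : Type u} [TopologicalSpace X] [TopologicalSpace Y] {p : Y → X}
    (hp : IsCoveringMap p) :
    IsCoveringMap (fun z : {z : Y × Y // p z.1 = p z.2} => z.1.1) := by
  intro y
  obtain ⟨hI, U, hyU, hU, hpU, H, hH⟩ := hp (p y)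
  refine IsEvenlyCovered.to_isEvenlyCovered_preimage (I := p ⁻¹' {p y})
    ⟨hI, p ⁻¹' U, hyU, hpU, hpU.preimage (by fun_prop), ?_⟩
  refine ⟨⟨⟨fun z => (⟨z.1.1.1, z.2⟩, (H ⟨z.1.1.2, by
      have h1 := z.1.2; have h2 := z.2
      simp only [Set.mem_preimage] at h2 ⊢; rwa [← h1]⟩).2),
    fun w => ⟨⟨(w.1.1, (H.symm (⟨p w.1.1, w.1.2⟩, w.2)).1), by
      have := hH (H.symm (⟨p w.1.1, w.1.2⟩, w.2))
      simpa using this⟩, w.1.2⟩, ?_, ?_⟩, ?_, ?_⟩, fun _ => rfl⟩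
  · rintro ⟨⟨⟨a, b⟩, h⟩, ha⟩
    have hb : b ∈ p ⁻¹' U := by
      simp only [Set.mem_preimage] at ha ⊢; rwa [← h]
    have : ((⟨p a, ha⟩ : U), (H ⟨b, hb⟩).2) = H ⟨b, hb⟩ := by
      refine Prod.ext (Subtype.ext ?_) rfl
      rw [hH]; exact h
    simp [this]
  · rintro ⟨⟨a, ha⟩, i⟩
    simp
  · have : Continuous p := hp.continuous
    fun_prop
  · have : Continuous p := hp.continuous
    fun_prop

variable {X Y : TopCat.{u}} (φ : Y ⟶ X)

theorem surjective [ConnectedSpace X] [IsUniversalCovering φ] : Function.Surjective φ := by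
  have hφ : IsCoveringMap φ := IsUniversalCovering.isCoveringMap
  have := (IsUniversalCovering.isSimplyConnected φ).connectedSpace
  have hc : IsClosed (Set.range φ) := by
    rw [← isOpen_compl_iff, isOpen_iff_mem_nhds]
    intro x hx
    obtain ⟨-, U, hxU, hU, -, H, -⟩ := hφ x
    refine Filter.mem_of_superset (hU.mem_nhds hxU) ?_
    rintro _ hyU ⟨y, rfl⟩
    exact hx ⟨_, (H ⟨y, hyU⟩).2.2⟩
  rw [← Set.range_eq_univ]
  exact IsClopen.eq_univ ⟨hc, hφ.isOpenMap.isOpen_range⟩ (Set.range_nonempty _)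

theorem deck_ext [IsUniversalCovering φ] {g h : Deck φ} (y : Y) (hy : g.1 y = h.1 y) : g = h := by
  have := (IsUniversalCovering.isSimplyConnected φ).connectedSpace
  refine Subtype.ext (Homeomorph.ext fun z => congrFun ?_ z)
  refine (IsUniversalCovering.isCoveringMap (φ := φ)).eq_of_comp_eq g.1.continuous h.1.continuous
    (funext fun z => ?_) y hy
  exact (g.2 z).trans (h.2 z).symm

theorem exists_deck [IsUniversalCovering φ] {y z : Y} (h : φ y = φ z) :
    ∃ g : Deck φ, g.1 y = z := by
  have hs := IsUniversalCovering.isSimplyConnected φ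
  have hφ : IsCoveringMap φ := IsUniversalCovering.isCoveringMap
  have := hs.connectedSpace
  obtain ⟨I, _, _, e, he⟩ := hs.exists_trivialization _ _ (isCoveringMap_fst hφ)
  have key : ∀ y z : Y, φ y = φ z → ∃ f : Y → Y, Continuous f ∧ φ ∘ f = φ ∧ f y = z := by
    intro y z h
    refine ⟨fun w => (e.symm (w, (e ⟨(y, z), h⟩).2)).1.2, by fun_prop, ?_, ?_⟩
    · funext w
      have h1 := (e.symm (w, (e ⟨(y, z), h⟩).2)).2
      have h2 := he (e.symm (w, (e ⟨(y, z), h⟩).2))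
      rw [e.apply_symm_apply] at h2
      simp only at h2
      rw [← h2] at h1
      exact h1.symm
    · have : (y, (e ⟨(y, z), h⟩).2) = e ⟨(y, z), h⟩ := Prod.ext (he ⟨(y, z), h⟩).symm rfl
      simp only [this, e.symm_apply_apply]
  obtain ⟨f, hf, hf1, hf2⟩ := key y z h
  obtain ⟨f', hf', hf1', hf2'⟩ := key z y h.symm
  have h1 : f' ∘ f = id := hφ.eq_of_comp_eq (hf'.comp hf) continuous_id
    (by rw [← Function.comp_assoc, hf1', hf1]; rfl) y (by simp [hf2, hf2'])
  have h2 : f ∘ f' = id := hφ.eq_of_comp_eq (hf.comp hf') continuous_id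
    (by rw [← Function.comp_assoc, hf1, hf1']; rfl) z (by simp [hf2, hf2'])
  exact ⟨⟨⟨⟨f, f', congrFun h1, congrFun h2⟩, hf, hf'⟩, congrFun hf1⟩, hf2⟩

end Coverings

section Sheaves

/-- The category `Shv_k(X)` of sheaves of `k`-modules on `X`. -/
abbrev Shv (k : Type u) [Ring k] (X : TopCat.{u}) :=
  Sheaf (Opens.grothendieckTopology X) (ModuleCat.{u} k)

instance hasColimitsOfShape_discrete (k : Type u) [Ring k] (X : TopCat.{u}) (I : Type u) :
    HasColimitsOfShape (Discrete I) (Shv k X) :=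
  Sheaf.instHasColimitsOfShape

/-- The direct sum `k_X^{⊕ I}` of copies of the constant sheaf `k_X`. -/
noncomputable def freeSheaf (k : Type u) [Ring k] (X : TopCat.{u}) (I : Type u) : Shv k X :=
  ∐ fun _ : I => (constantSheaf (Opens.grothendieckTopology X) (ModuleCat.{u} k)).obj
    (ModuleCat.of k k)

/-- The restriction `F|_U` of a sheaf to an open subset. -/
abbrev restrict {k : Type u} [Ring k] {X : TopCat.{u}} (U : Opens X) (F : Shv k X) :
    Shv k (TopCat.of U) :=
  U.sheafRestrict.obj F

/-- A sheaf of `k`-modules is *quasi-coherent* if every point has an open neighbourhood `U`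
with an exact sequence `k_U^{⊕ I} ⟶ k_U^{⊕ J} ⟶ F|_U ⟶ 0` of sheaves on `U`. -/
def IsQuasicoherent (k : Type u) [Ring k] (X : TopCat.{u}) : ObjectProperty (Shv k X) := fun F =>
  ∀ x : X, ∃ U : Opens X, x ∈ U ∧ ∃ (I J : Type u)
    (f : freeSheaf k (TopCat.of U) I ⟶ freeSheaf k (TopCat.of U) J)
    (g : freeSheaf k (TopCat.of U) J ⟶ restrict U F) (w : f ≫ g = 0),
      (ShortComplex.mk f g w).Exact ∧ Epi g

/-- A sheaf of `k`-modules is *locally constant* if every point has an open neighbourhood on which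
the sheaf is isomorphic to a constant sheaf. -/
def IsLocallyConstantSheaf {k : Type u} [Ring k] {X : TopCat.{u}} (F : Shv k X) : Prop :=
  ∀ x : X, ∃ U : Opens X, x ∈ U ∧ ∃ M : ModuleCat.{u} k,
    Nonempty (restrict U F ≅ (constantSheaf (Opens.grothendieckTopology U) (ModuleCat.{u} k)).obj M)

/-- The full subcategory `Qcoh_k(X)` of quasi-coherent sheaves. -/
abbrev Qcoh (k : Type u) [Ring k] (X : TopCat.{u}) := (IsQuasicoherent k X).FullSubcategory

/-- The inclusion functor of the quasi-coherent sheaves into all sheaves. -/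
noncomputable abbrev incl (k : Type u) [Ring k] (X : TopCat.{u}) : Qcoh k X ⥤ Shv k X := (IsQuasicoherent k X).ι

/-- The direct image functor `φ_*`. -/
noncomputable def push {X Y : TopCat.{u}} (φ : Y ⟶ X) (k : Type u) [Ring k] : Shv k Y ⥤ Shv k X :=
  TopCat.Sheaf.pushforward (ModuleCat.{u} k) φ

/-- The inverse image functor `φ⁻¹`. -/
noncomputable def pull {X Y : TopCat.{u}} (φ : Y ⟶ X) (k : Type u) [Ring k] : Shv k X ⥤ Shv k Y :=
  TopCat.Sheaf.pullback (ModuleCat.{u} k) φ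

/-- The adjunction between the inverse image and the direct image. -/
noncomputable def pullPushAdj {X Y : TopCat.{u}} (φ : Y ⟶ X) (k : Type u) [Ring k] :
    pull φ k ⊣ push φ k :=
  TopCat.Sheaf.pullbackPushforwardAdjunction (ModuleCat.{u} k) φ

end Sheaves

section GlobalSections

variable {X Y : TopCat.{u}} (φ : Y ⟶ X) (k : Type u) [Ring k]

/-- An automorphism of `Y` over `X` as a morphism of topological spaces. -/
def deckHom (g : Deck φ) : Y ⟶ Y := TopCat.ofHom ⟨g.1, g.1.continuous⟩

variable {φ} in
theorem preimage_deckHom_le (g : Deck φ) (U : Opens X) :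
    (Opens.map (deckHom φ g)).obj ((Opens.map φ).obj U) ≤ (Opens.map φ).obj U := fun y hy => by
  have h : φ (g.1 y) ∈ U := hy
  rw [g.2 y] at h
  exact h

variable {φ k} in
/-- The identification `Q(φ⁻¹ U) ⟶ Q(g⁻¹ φ⁻¹ U)` coming from `φ ∘ g = φ`. -/
def deckRes (g : Deck φ) (Q : Shv k Y) (U : Opens X) :
    Q.1.obj (op ((Opens.map φ).obj U)) ⟶
      Q.1.obj (op ((Opens.map (deckHom φ g)).obj ((Opens.map φ).obj U))) :=
  Q.1.map (homOfLE (preimage_deckHom_le g U)).op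

variable {φ k} in
/-- The canonical identification `φ_* Q ⟶ φ_* (g_* Q)` coming from `φ ∘ g = φ`. -/
def pushDeck (g : Deck φ) (Q : Shv k Y) :
    (push φ k).obj Q ⟶ (push φ k).obj ((push (deckHom φ g) k).obj Q) :=
  ⟨{ app U := deckRes g Q U.unop
     naturality U V i := by
        change Q.1.map _ ≫ Q.1.map _ = Q.1.map _ ≫ Q.1.map _
        rw [← Q.1.map_comp, ← Q.1.map_comp]
        rfl }⟩

/-- The action of `g` on `φ⁻¹ F`: the morphism `φ⁻¹ F ⟶ g_* φ⁻¹ F` that corresponds, by adjunction,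
to `F ⟶ φ_* φ⁻¹ F = φ_* g_* φ⁻¹ F`. On sections it is the pull-back `s ↦ s ∘ g`. -/
noncomputable def deckPull (g : Deck φ) (F : Shv k X) :
    (pull φ k).obj F ⟶ (push (deckHom φ g) k).obj ((pull φ k).obj F) :=
  ((pullPushAdj φ k).homEquiv _ _).symm ((pullPushAdj φ k).unit.app F ≫ pushDeck g _)

variable {φ k} in
/-- The pull-back `s ↦ s ∘ g` on sections over `V`. -/
noncomputable def deckPullApp (g : Deck φ) (F : Shv k X) (V : Opens Y) :
    ((pull φ k).obj F).1.obj (op V) ⟶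
      ((pull φ k).obj F).1.obj (op ((Opens.map (deckHom φ g)).obj V)) :=
  (deckPull φ k g F).1.app (op V)

variable {φ k} in
/-- The unit `F(U) ⟶ (φ⁻¹ F)(φ⁻¹ U)`. -/
noncomputable def unitApp (F : Shv k X) (U : Opens X) :
    F.1.obj (op U) ⟶ ((pull φ k).obj F).1.obj (op ((Opens.map φ).obj U)) :=
  ((pullPushAdj φ k).unit.app F).1.app (op U)

variable {φ k} in
theorem pullback_hom_ext {F : Shv k X} {Q : Shv k Y} {a b : (pull φ k).obj F ⟶ Q}
    (h : ∀ U : Opens X, unitApp F U ≫ a.1.app (op ((Opens.map φ).obj U)) =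
      unitApp F U ≫ b.1.app (op ((Opens.map φ).obj U))) : a = b := by
  apply ((pullPushAdj φ k).homEquiv _ _).injective
  rw [Adjunction.homEquiv_unit, Adjunction.homEquiv_unit]
  apply CategoryTheory.Sheaf.hom_ext
  apply NatTrans.ext
  funext U
  exact h U.unop

theorem unit_deckPull (g : Deck φ) (F : Shv k X) (U : Opens X) :
    unitApp F U ≫ deckPullApp g F ((Opens.map φ).obj U) =
      unitApp F U ≫ deckRes g ((pull φ k).obj F) U := by
  have h : (pullPushAdj φ k).unit.app F ≫ (push φ k).map (deckPull φ k g F) =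
      (pullPushAdj φ k).unit.app F ≫ pushDeck g _ :=
    ((pullPushAdj φ k).homEquiv_unit ..).symm.trans
      (((pullPushAdj φ k).homEquiv _ _).apply_symm_apply _)
  exact congrArg (fun (f : F ⟶ (push φ k).obj ((push (deckHom φ g) k).obj ((pull φ k).obj F))) =>
    f.1.app (op U)) h

theorem deckPull_one (F : Shv k X) (V : Opens Y) :
    deckPullApp (1 : Deck φ) F V = 𝟙 (((pull φ k).obj F).1.obj (op V)) := by
  have h : deckPull φ k 1 F = 𝟙 ((pull φ k).obj F) := by
    apply pullback_hom_ext
    intro U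
    refine (unit_deckPull φ k 1 F U).trans ?_
    exact congrArg (unitApp F U ≫ ·) (((pull φ k).obj F).1.map_id _)
  exact congrArg (fun (f : (pull φ k).obj F ⟶ (pull φ k).obj F) => f.1.app (op V)) h

theorem deckPull_res (g h : Deck φ) (F : Shv k X) (U : Opens X) :
    deckRes g ((pull φ k).obj F) U ≫ deckPullApp h F _ =
      deckPullApp h F ((Opens.map φ).obj U) ≫
        ((pull φ k).obj F).1.map
          ((Opens.map (deckHom φ h)).map (homOfLE (preimage_deckHom_le g U))).op :=
  (deckPull φ k h F).1.naturality _

theorem deckPull_mul (g h : Deck φ) (F : Shv k X) (V : Opens Y) : deckPullApp (g * h) F V =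
    deckPullApp g F V ≫ deckPullApp h F ((Opens.map (deckHom φ g)).obj V) := by
  have key : deckPull φ k (g * h) F =
      deckPull φ k g F ≫ (push (deckHom φ g) k).map (deckPull φ k h F) := by
    apply pullback_hom_ext
    intro U
    have h1 : unitApp F U ≫ deckPullApp g F ((Opens.map φ).obj U) ≫
        deckPullApp h F ((Opens.map (deckHom φ g)).obj ((Opens.map φ).obj U)) =
        unitApp F U ≫ deckRes (g * h) ((pull φ k).obj F) U := by
      rw [← Category.assoc, unit_deckPull, Category.assoc, deckPull_res, ← Category.assoc,
        unit_deckPull, Category.assoc]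
      exact congrArg (unitApp F U ≫ ·) (((pull φ k).obj F).1.map_comp _ _).symm
    exact (unit_deckPull φ k (g * h) F U).trans h1.symm
  exact congrArg (fun (f : (pull φ k).obj F ⟶ (push (deckHom φ (g * h)) k).obj ((pull φ k).obj F)) =>
    f.1.app (op V)) key

variable {φ k} in
/-- The map induced by `f : F ⟶ F'` on sections of the inverse images. -/
noncomputable def pullApp {F F' : Shv k X} (f : F ⟶ F') (V : Opens Y) :
    ((pull φ k).obj F).1.obj (op V) ⟶ ((pull φ k).obj F').1.obj (op V) :=
  ((pull φ k).map f).1.app (op V)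

theorem unitApp_naturality {F F' : Shv k X} (f : F ⟶ F') (U : Opens X) :
    unitApp F U ≫ pullApp (φ := φ) f ((Opens.map φ).obj U) = f.1.app (op U) ≫ unitApp F' U :=
  (congrArg (fun (f : F ⟶ (push φ k).obj ((pull φ k).obj F')) => f.1.app (op U))
    ((pullPushAdj φ k).unit.naturality f)).symm

theorem pullApp_deckRes (g : Deck φ) {F F' : Shv k X} (f : F ⟶ F') (U : Opens X) :
    deckRes g ((pull φ k).obj F) U ≫ pullApp f _ =
      pullApp f ((Opens.map φ).obj U) ≫ deckRes g ((pull φ k).obj F') U :=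
  ((pull φ k).map f).1.naturality _

theorem deckPull_naturality (g : Deck φ) {F F' : Shv k X} (f : F ⟶ F') (V : Opens Y) :
    pullApp f V ≫ deckPullApp g F' V =
      deckPullApp g F V ≫ pullApp f ((Opens.map (deckHom φ g)).obj V) := by
  have key : (pull φ k).map f ≫ deckPull φ k g F' =
      deckPull φ k g F ≫ (push (deckHom φ g) k).map ((pull φ k).map f) := by
    apply pullback_hom_ext
    intro U
    have h1 : unitApp F U ≫ pullApp f ((Opens.map φ).obj U) ≫
          deckPullApp g F' ((Opens.map φ).obj U) =
        unitApp F U ≫ deckPullApp g F ((Opens.map φ).obj U) ≫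
          pullApp f ((Opens.map (deckHom φ g)).obj ((Opens.map φ).obj U)) := by
      rw [← Category.assoc, ← Category.assoc, unit_deckPull, unitApp_naturality, Category.assoc,
        unit_deckPull, Category.assoc, pullApp_deckRes, ← Category.assoc, ← Category.assoc,
        unitApp_naturality]
    exact h1
  exact congrArg (fun (f : (pull φ k).obj F ⟶ (push (deckHom φ g) k).obj ((pull φ k).obj F')) =>
    f.1.app (op V)) key

/-- The functor `F ↦ Γ(Y, φ⁻¹ F)` from sheaves on `X` to `G`-modules, `G = Aut_X Y`:
the element `g` acts by `s ↦ s ∘ g⁻¹`. -/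
noncomputable def sectionsRep : Shv k X ⥤ Rep.{u} k (Deck φ) where
  obj F := Rep.of (X := ((pull φ k).obj F).1.obj (op ⊤))
    { toFun g := (deckPullApp g⁻¹ F ⊤).hom
      map_one' := by
        rw [inv_one]
        exact congrArg ModuleCat.Hom.hom (deckPull_one φ k F ⊤)
      map_mul' g h := by
        rw [mul_inv_rev]
        exact congrArg ModuleCat.Hom.hom (deckPull_mul φ k h⁻¹ g⁻¹ F ⊤) }
  map {F F'} f := Rep.ofHom ⟨(pullApp f ⊤).hom, fun g =>
    (congrArg ModuleCat.Hom.hom (deckPull_naturality φ k g⁻¹ f ⊤)).symm⟩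
  map_id F := by
    apply Rep.hom_ext
    apply Representation.IntertwiningMap.ext
    exact congrArg (fun (a : (pull φ k).obj F ⟶ (pull φ k).obj F) => (a.1.app (op ⊤)).hom)
      ((pull φ k).map_id F)
  map_comp {F F' F''} f g := by
    apply Rep.hom_ext
    apply Representation.IntertwiningMap.ext
    exact congrArg (fun (a : (pull φ k).obj F ⟶ (pull φ k).obj F'') => (a.1.app (op ⊤)).hom)
      ((pull φ k).map_comp f g)

end GlobalSections

section AssociatedSheaf

variable {X Y : TopCat.{u}} (φ : Y ⟶ X) {k : Type u} [Ring k] (E : Rep.{u} k (Deck φ))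

/-- The orbit relation of the diagonal action `g (y, e) = (g y, g e)` on `Y × E`. -/
def orbitSetoid : Setoid (Y × E) where
  r a b := ∃ g : Deck φ, g.1 a.1 = b.1 ∧ E.ρ g a.2 = b.2
  iseqv :=
    { refl a := ⟨1, rfl, by rw [map_one]; rfl⟩
      symm := by
        rintro ⟨y, e⟩ ⟨_, _⟩ ⟨g, rfl, rfl⟩
        exact ⟨g⁻¹, g.1.symm_apply_apply y, by
          rw [← Module.End.mul_apply, ← map_mul, inv_mul_cancel, map_one]; rfl⟩
      trans := by
        rintro ⟨y, e⟩ ⟨_, _⟩ ⟨_, _⟩ ⟨g, rfl, rfl⟩ ⟨h, rfl, rfl⟩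
        exact ⟨h * g, rfl, by rw [map_mul]; rfl⟩ }

/-- The quotient `(Y × E) / G` by the diagonal action of `G = Aut_X Y`. -/
def AssocSpace : Type u := Quotient (orbitSetoid φ E)

/-- The class of `(y, e)` in `(Y × E) / G`. -/
def AssocSpace.mk (y : Y) (e : E) : AssocSpace φ E := Quotient.mk (orbitSetoid φ E) (y, e)

/-- The quotient topology, `E` being discrete. -/
instance : TopologicalSpace (AssocSpace φ E) :=
  letI : TopologicalSpace E := ⊥
  inferInstanceAs (TopologicalSpace (Quotient (orbitSetoid φ E)))

/-- The projection `(Y × E) / G ⟶ Y / G = X` induced by `φ`. -/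
def AssocSpace.proj : AssocSpace φ E → X :=
  Quotient.lift (fun a => φ a.1) (by
    rintro ⟨y, e⟩ ⟨_, _⟩ ⟨g, rfl, rfl⟩
    exact (g.2 y).symm)

namespace AssocSpace

variable {φ E}

theorem continuous_mk (e : E) : Continuous fun y => AssocSpace.mk φ E y e := by
  let _ : TopologicalSpace E := ⊥
  exact continuous_quotient_mk'.comp (Continuous.prodMk continuous_id continuous_const)

theorem mk_eq_mk {y z : Y} {e f : E} :
    AssocSpace.mk φ E y e = AssocSpace.mk φ E z f ↔ ∃ g : Deck φ, g.1 y = z ∧ E.ρ g e = f :=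
  Quotient.eq (r := orbitSetoid φ E)

theorem isOpen_image {V : Set Y} (hV : IsOpen V) (e : E) :
    IsOpen ((fun y => AssocSpace.mk φ E y e) '' V) := by
  let _ : TopologicalSpace E := ⊥
  have : DiscreteTopology E := ⟨rfl⟩
  refine isOpen_coinduced.2 ?_
  have : (Quotient.mk (orbitSetoid φ E)) ⁻¹' ((fun y => AssocSpace.mk φ E y e) '' V) =
      ⋃ g : Deck φ, (g.1 '' V) ×ˢ {E.ρ g e} := by
    ext ⟨z, f⟩
    simp only [Set.mem_preimage, Set.mem_image, Set.mem_iUnion, Set.mem_prod,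
      Set.mem_singleton_iff]
    constructor
    · rintro ⟨y, hy, h⟩
      obtain ⟨g, h1, h2⟩ := mk_eq_mk.1 h
      exact ⟨g, ⟨y, hy, h1⟩, h2.symm⟩
    · rintro ⟨g, ⟨y, hy, h1⟩, h2⟩
      exact ⟨y, hy, mk_eq_mk.2 ⟨g, h1, h2.symm⟩⟩
  exact this ▸ isOpen_iUnion fun g => (g.1.isOpenMap V hV).prod (isOpen_discrete _)

theorem mk_injective [IsUniversalCovering φ] (y : Y) :
    Function.Injective (AssocSpace.mk φ E y) := by
  intro e f h
  obtain ⟨g, h1, h2⟩ := mk_eq_mk.1 h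
  obtain rfl : g = 1 := deck_ext φ y h1
  rw [← h2, map_one]; rfl

theorem exists_mk [IsUniversalCovering φ] (a : AssocSpace φ E) (y : Y)
    (h : AssocSpace.proj φ E a = φ y) : ∃ e : E, AssocSpace.mk φ E y e = a := by
  induction a using Quotient.inductionOn with
  | h a =>
    obtain ⟨z, e⟩ := a
    obtain ⟨g, hg⟩ := exists_deck φ (y := z) (z := y) h
    exact ⟨E.ρ g e, (mk_eq_mk.2 ⟨g, hg, rfl⟩).symm⟩

end AssocSpace

/-- The fibre of `(Y × E) / G ⟶ X` over `x`. -/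
def Fibre (x : X) : Type u := {a : AssocSpace φ E // AssocSpace.proj φ E a = x}

variable {φ E} in
/-- An element of the fibre as a point of `(Y × E) / G`. -/
def Fibre.val {x : X} (a : Fibre φ E x) : AssocSpace φ E := Subtype.val a

variable {φ E} in
theorem Fibre.proj_val {x : X} (a : Fibre φ E x) : AssocSpace.proj φ E a.val = x := Subtype.prop a

variable {φ E} in
theorem Fibre.ext {x : X} {a b : Fibre φ E x} (h : a.val = b.val) : a = b := Subtype.ext h

variable {φ E} in
/-- The class of `(y, e)` as an element of the fibre over `φ y = x`. -/
def Fibre.mk {x : X} (y : Y) (hy : φ y = x) (e : E) : Fibre φ E x := ⟨AssocSpace.mk φ E y e, hy⟩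

section

variable [IsUniversalCovering φ]

theorem Fibre.mk_bijective {x : X} (y : Y) (hy : φ y = x) :
    Function.Bijective (Fibre.mk (E := E) y hy) := by
  refine ⟨fun e f h => AssocSpace.mk_injective y (congrArg Fibre.val h), fun a => ?_⟩
  obtain ⟨e, he⟩ := AssocSpace.exists_mk a.val y (a.proj_val.trans hy.symm)
  exact ⟨e, Fibre.ext he⟩

/-- A point `y` over `x` identifies `E` with the fibre over `x`, through `e ↦ [y, e]`. -/
noncomputable def Fibre.equiv {x : X} (y : Y) (hy : φ y = x) : Fibre φ E x ≃ E :=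
  (Equiv.ofBijective _ (Fibre.mk_bijective φ E y hy)).symm

variable [ConnectedSpace X]

noncomputable instance (x : X) : AddCommGroup (Fibre φ E x) :=
  (Fibre.equiv φ E (surjective φ x).choose (surjective φ x).choose_spec).addCommGroup

/-- The `k`-module structure on the fibre over `x`, transported from `E` along `e ↦ [y, e]`
for a point `y` over `x`; it does not depend on `y`, see `Fibre.mk_add` and `Fibre.mk_smul`. -/
noncomputable instance (x : X) : Module k (Fibre φ E x) :=
  (Fibre.equiv φ E (surjective φ x).choose (surjective φ x).choose_spec).module k

variable {φ E} in
/-- The bijection `e ↦ [y, e]` is `k`-linear for every `y` over `x`. -/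
theorem Fibre.exists_linearEquiv {x : X} (y : Y) (hy : φ y = x) :
    ∃ l : E ≃ₗ[k] Fibre φ E x, ∀ e, l e = Fibre.mk y hy e := by
  let y₀ := (surjective φ x).choose
  have hy₀ : φ y₀ = x := (surjective φ x).choose_spec
  let l₀ : Fibre φ E x ≃ₗ[k] E := (Fibre.equiv φ E y₀ hy₀).linearEquiv k
  obtain ⟨g, hg⟩ := exists_deck φ (hy.trans hy₀.symm)
  refine ⟨(LinearEquiv.ofBijective (E.ρ g) ⟨?_, ?_⟩).trans l₀.symm, fun e => ?_⟩
  · exact Function.LeftInverse.injective (g := E.ρ g⁻¹) fun e => by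
      rw [← Module.End.mul_apply, ← map_mul, inv_mul_cancel, map_one]; rfl
  · exact Function.RightInverse.surjective (g := E.ρ g⁻¹) fun e => by
      rw [← Module.End.mul_apply, ← map_mul, mul_inv_cancel, map_one]; rfl
  · refine Fibre.ext ?_
    exact (AssocSpace.mk_eq_mk.2 ⟨g, hg, rfl⟩).symm

variable {φ E}

theorem Fibre.mk_add {x : X} (y : Y) (hy : φ y = x) (e f : E) :
    Fibre.mk y hy (e + f) = Fibre.mk y hy e + Fibre.mk (E := E) y hy f := by
  obtain ⟨l, hl⟩ := Fibre.exists_linearEquiv (E := E) y hy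
  rw [← hl, ← hl, ← hl, map_add]

theorem Fibre.mk_smul {x : X} (y : Y) (hy : φ y = x) (c : k) (e : E) :
    Fibre.mk y hy (c • e) = c • Fibre.mk (E := E) y hy e := by
  obtain ⟨l, hl⟩ := Fibre.exists_linearEquiv (E := E) y hy
  rw [← hl, ← hl, map_smul]

theorem Fibre.mk_zero {x : X} (y : Y) (hy : φ y = x) :
    Fibre.mk y hy 0 = (0 : Fibre φ E x) := by
  obtain ⟨l, hl⟩ := Fibre.exists_linearEquiv (E := E) y hy
  rw [← hl, map_zero]

/-- A family of elements of the fibres is continuous at `x = φ y` exactly if it is of the form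
`φ z ↦ [z, e]`, with `e` fixed, for all `z` near `y`. -/
theorem continuousAt_iff (U : Opens X) (s : ∀ x : U, Fibre φ E x) (y : Y) (hy : φ y ∈ U) (e : E)
    (he : s ⟨φ y, hy⟩ = Fibre.mk y rfl e) :
    ContinuousAt (fun x => (s x).val) ⟨φ y, hy⟩ ↔
      ∀ᶠ z in 𝓝 y, ∀ hz : φ z ∈ U, s ⟨φ z, hz⟩ = Fibre.mk z rfl e := by
  have hφ : IsCoveringMap φ := IsUniversalCovering.isCoveringMap
  obtain ⟨V, hVy, hVi⟩ : ∃ V ∈ 𝓝 y, Set.InjOn φ V := by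
    obtain ⟨f, hf, hf'⟩ := hφ.isLocalHomeomorph y
    exact ⟨f.source, f.open_source.mem_nhds hf, hf' ▸ f.injOn⟩
  obtain ⟨V', hV'V, hV', hyV'⟩ := mem_nhds_iff.1 hVy
  constructor
  · intro h
    have h1 := h ((AssocSpace.isOpen_image (E := E) hV' e).mem_nhds ⟨y, hyV', by
      exact (congrArg Fibre.val he).symm⟩)
    have h2 : ContinuousAt φ y := hφ.continuous.continuousAt
    have h3 : ∀ᶠ x in 𝓝 (φ y), ∀ hx : x ∈ U, (s ⟨x, hx⟩).val ∈
        (fun y => AssocSpace.mk φ E y e) '' V' := by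
      have := (U.isOpenEmbedding'.map_nhds_eq ⟨φ y, hy⟩)
      change ∀ᶠ x in 𝓝 ((⟨φ y, hy⟩ : U) : X), _
      rw [← this, Filter.eventually_map]
      filter_upwards [h1] with x hx _
      exact hx
    filter_upwards [h2.eventually h3, hV'.mem_nhds hyV'] with z hz hzV hzU
    obtain ⟨w, hw, hwz⟩ := hz hzU
    have : φ w = φ z := (congrArg (AssocSpace.proj φ E) hwz).trans (s ⟨φ z, hzU⟩).proj_val
    obtain rfl := hVi (hV'V hw) (hV'V hzV) this
    exact Fibre.ext hwz.symm
  · intro h W hW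
    have hW' : ∀ᶠ z in 𝓝 y, AssocSpace.mk φ E z e ∈ W :=
      (AssocSpace.continuous_mk e).continuousAt (by
        change W ∈ 𝓝 (s ⟨φ y, hy⟩).val at hW
        rwa [he] at hW)
    have h4 : ∀ᶠ x in 𝓝 (φ y), ∀ hx : x ∈ U, (s ⟨x, hx⟩).val ∈ W := by
      rw [← hφ.isLocalHomeomorph.map_nhds_eq, Filter.eventually_map]
      filter_upwards [h, hW'] with z hz hzW hzU
      rw [hz hzU]
      exact hzW
    have h5 := (continuous_subtype_val.continuousAt (x := (⟨φ y, hy⟩ : U))).eventually h4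
    exact h5.mono fun x hx => hx x.2

theorem continuous_iff (U : Opens X) (s : ∀ x : U, Fibre φ E x) :
    Continuous (fun x => (s x).val) ↔ ∀ (y : Y) (hy : φ y ∈ U),
      ∃ e : E, ∀ᶠ z in 𝓝 y, ∀ hz : φ z ∈ U, s ⟨φ z, hz⟩ = Fibre.mk z rfl e := by
  constructor
  · intro h y hy
    obtain ⟨e, he⟩ := (Fibre.mk_bijective φ E y rfl).2 (s ⟨φ y, hy⟩)
    exact ⟨e, (continuousAt_iff U s y hy e he.symm).1 h.continuousAt⟩
  · intro h
    rw [continuous_iff_continuousAt]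
    rintro ⟨x, hx⟩
    obtain ⟨y, rfl⟩ := surjective φ x
    obtain ⟨e, he⟩ := h y hx
    exact (continuousAt_iff U s y hx e (he.self_of_nhds hx)).2 he

variable (φ E)

/-- The `k`-module of continuous sections of `(Y × E) / G ⟶ X` over `U`, with the fibrewise
operations. -/
noncomputable def assocSections (U : Opens X) : Submodule k (∀ x : U, Fibre φ E x) where
  carrier := {s | Continuous fun x => (s x).val}
  add_mem' {s t} hs ht := (continuous_iff U _).2 fun y hy => by
    obtain ⟨e, he⟩ := (continuous_iff U s).1 hs y hy
    obtain ⟨f, hf⟩ := (continuous_iff U t).1 ht y hy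
    refine ⟨e + f, ?_⟩
    filter_upwards [he, hf] with z hz hz' hzU
    rw [Fibre.mk_add, ← hz hzU, ← hz' hzU]; rfl
  zero_mem' := (continuous_iff U _).2 fun _ _ => ⟨0, Filter.Eventually.of_forall fun z hz => by
    rw [Fibre.mk_zero]; rfl⟩
  smul_mem' c s hs := (continuous_iff U _).2 fun y hy => by
    obtain ⟨e, he⟩ := (continuous_iff U s).1 hs y hy
    refine ⟨c • e, ?_⟩
    filter_upwards [he] with z hz hzU
    rw [Fibre.mk_smul, ← hz hzU]; rfl

/-- The presheaf of sections of `(Y × E) / G ⟶ X`. -/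
noncomputable def assocPresheaf : (Opens X)ᵒᵖ ⥤ ModuleCat.{u} k where
  obj U := ModuleCat.of k (assocSections φ E U.unop)
  map {U V} i := ModuleCat.ofHom
    { toFun s := ⟨fun x => s.1 ⟨x.1, i.unop.le x.2⟩,
        s.2.comp (continuous_subtype_val.subtype_mk fun x => i.unop.le x.2)⟩
      map_add' _ _ := rfl
      map_smul' _ _ := rfl }

/-- Continuity of a family of elements of the fibres is a local condition. -/
def continuousSection : TopCat.LocalPredicate (Fibre φ E) where
  pred {U} s := Continuous fun x => (s x).val
  res {U V} i s hs := hs.comp (continuous_subtype_val.subtype_mk fun x => i.le x.2)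
  locality {U} s h := by
    rw [continuous_iff_continuousAt]
    intro x
    obtain ⟨V, hxV, i, hV⟩ := h x
    exact ((Opens.isOpenEmbedding_of_le i.le).continuousAt_iff (x := (⟨x.1, hxV⟩ : V))).1
      hV.continuousAt

theorem assocPresheaf_isSheaf :
    Presheaf.IsSheaf (Opens.grothendieckTopology X) (assocPresheaf φ E) :=
  (TopCat.Presheaf.isSheaf_iff_isSheaf_comp (forget (ModuleCat.{u} k)) (X := X)
    (assocPresheaf φ E)).2
    (TopCat.subpresheafToTypes.isSheaf (continuousSection φ E))

/-- The sheaf `𝓛_E` of sections of `(Y × E) / G ⟶ X`. -/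
noncomputable def assocSheaf : Shv k X := ⟨assocPresheaf φ E, assocPresheaf_isSheaf φ E⟩

end

section Functoriality

variable {φ} {E} {E' E'' : Rep.{u} k (Deck φ)}

/-- The map `[y, e] ↦ [y, f e]` induced by a morphism of `G`-modules. -/
def AssocSpace.map (f : E ⟶ E') : AssocSpace φ E → AssocSpace φ E' :=
  Quotient.map (fun a => (a.1, f.hom a.2)) (by
    rintro ⟨y, e⟩ ⟨_, _⟩ ⟨g, rfl, rfl⟩
    exact ⟨g, rfl, (Rep.hom_comm_apply f g e).symm⟩)

/-- The map induced by a morphism of `G`-modules on the fibres. -/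
def Fibre.map (f : E ⟶ E') {x : X} (a : Fibre φ E x) : Fibre φ E' x :=
  ⟨AssocSpace.map f a.val, by
    obtain ⟨a, rfl⟩ := a
    induction a using Quotient.inductionOn with
    | h a => rfl⟩

theorem Fibre.map_mk (f : E ⟶ E') {x : X} (y : Y) (hy : φ y = x) (e : E) :
    Fibre.map f (Fibre.mk y hy e) = Fibre.mk y hy (f.hom e) := rfl

theorem Fibre.map_id {x : X} (a : Fibre φ E x) : Fibre.map (𝟙 E) a = a := by
  obtain ⟨a, rfl⟩ := a
  induction a using Quotient.inductionOn with
  | h a => rfl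

theorem Fibre.map_comp (f : E ⟶ E') (g : E' ⟶ E'') {x : X} (a : Fibre φ E x) :
    Fibre.map (f ≫ g) a = Fibre.map g (Fibre.map f a) := by
  obtain ⟨a, rfl⟩ := a
  induction a using Quotient.inductionOn with
  | h a => rfl

variable [IsUniversalCovering φ] [ConnectedSpace X]

/-- The map induced by a morphism of `G`-modules on the sections over `U`. -/
noncomputable def assocSectionsMap (f : E ⟶ E') (U : Opens X) :
    assocSections φ E U →ₗ[k] assocSections φ E' U where
  toFun s := ⟨fun x => Fibre.map f (s.1 x), (continuous_iff U _).2 fun y hy => by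
    obtain ⟨e, he⟩ := (continuous_iff U s.1).1 s.2 y hy
    refine ⟨f.hom e, ?_⟩
    filter_upwards [he] with z hz hzU
    rw [hz hzU, Fibre.map_mk]⟩
  map_add' s t := by
    refine Subtype.ext (funext fun x => ?_)
    obtain ⟨y, hy⟩ := surjective φ x.1
    obtain ⟨e, he⟩ := (Fibre.mk_bijective φ E y hy).2 (s.1 x)
    obtain ⟨e', he'⟩ := (Fibre.mk_bijective φ E y hy).2 (t.1 x)
    change Fibre.map f (s.1 x + t.1 x) = Fibre.map f (s.1 x) + Fibre.map f (t.1 x)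
    rw [← he, ← he', ← Fibre.mk_add, Fibre.map_mk, Fibre.map_mk, Fibre.map_mk, ← Fibre.mk_add,
      map_add]
  map_smul' c s := by
    refine Subtype.ext (funext fun x => ?_)
    obtain ⟨y, hy⟩ := surjective φ x.1
    obtain ⟨e, he⟩ := (Fibre.mk_bijective φ E y hy).2 (s.1 x)
    change Fibre.map f (c • s.1 x) = c • Fibre.map f (s.1 x)
    rw [← he, ← Fibre.mk_smul, Fibre.map_mk, Fibre.map_mk, ← Fibre.mk_smul, map_smul]

end Functoriality

/-- The functor `E ↦ 𝓛_E` from `G`-modules to sheaves on `X`. -/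
noncomputable def assocFunctor (k : Type u) [Ring k] [IsUniversalCovering φ] [ConnectedSpace X] :
    Rep.{u} k (Deck φ) ⥤ Shv k X where
  obj E := assocSheaf φ E
  map f := ⟨{ app U := ModuleCat.ofHom (assocSectionsMap f U.unop)
              naturality _ _ _ := rfl }⟩
  map_id E := by
    apply Sheaf.hom_ext
    apply NatTrans.ext
    funext U
    apply ModuleCat.hom_ext
    apply LinearMap.ext
    intro s
    exact Subtype.ext (funext fun x => Fibre.map_id _)
  map_comp f g := by
    apply Sheaf.hom_ext
    apply NatTrans.ext
    funext U
    apply ModuleCat.hom_ext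
    apply LinearMap.ext
    intro s
    exact Subtype.ext (funext fun x => Fibre.map_comp f g _)

end AssociatedSheaf

end QuasiCoherator

/-! Write `Y` for the universal covering. The core is an adjunction on all sheaves: `E ↦ 𝓛_E` is
left adjoint to `F ↦ Γ(Y, φ⁻¹ F)` (`assocAdjunction`). The stalk of `𝓛_E` at `x` consists of the
classes `[y, e]` with `φ y = x`. A `G`-map `a : E ⟶ Γ(Y, φ⁻¹ F)` gives the stalk maps `[y, e] ↦
a(e)(y)`: equivariance makes them independent of the representative, and they respect local sections
because `a(e)` is locally the inverse image of a section of `F`.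

The unit of this adjunction is an isomorphism (`unitRep_bijective`): a global section of `φ⁻¹ 𝓛_E`
is a locally constant map `Y → E`, and `Y` is connected. Hence `E ↦ 𝓛_E` is fully faithful.

Its essential image is the category of quasi-coherent sheaves. Each `𝓛_E` is locally constant, and a
constant sheaf inherits a presentation from its module. Conversely, over a connected open set a
morphism of constant sheaves comes from one linear map, so its cokernel is again constant; thus
quasi-coherent sheaves are locally constant (`IsQuasicoherent.isLocallyTrivial`). If `F` is locally
constant, the étalé space of `φ⁻¹ F` is a covering of `Y`, hence trivial, so every germ extends
uniquely to `Y` (`germ_top_bijective`). Then `Γ(Y, φ⁻¹ F)` is identified with each stalk of `F`, and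
the counit is an isomorphism (`IsLocallyTrivial.nonempty_iso`).

Up to this equivalence the inclusion of the quasi-coherent sheaves is therefore `E ↦ 𝓛_E`, and
uniqueness of right adjoints gives the formula for `Qc`. -/

namespace QuasiCoherator

/-! ### Sections and morphisms of sheaves in terms of germs -/

section Stalks

variable {k : Type u} [Ring k] {X : TopCat.{u}}

/-- The stalk of a sheaf of `k`-modules. -/
noncomputable abbrev Stalk (F : Shv k X) (x : X) : ModuleCat.{u} k :=
  TopCat.Presheaf.stalk (C := ModuleCat.{u} k) F.1 x

/-- The germ of a section, as a linear map. -/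
noncomputable def germ (F : Shv k X) (U : Opens X) (x : X) (hx : x ∈ U) :
    F.1.obj (op U) →ₗ[k] Stalk F x :=
  (TopCat.Presheaf.germ (C := ModuleCat.{u} k) F.1 U x hx).hom

/-- The restriction of sections, as a linear map. -/
def res (F : Shv k X) {U V : Opens X} (h : V ≤ U) : F.1.obj (op U) →ₗ[k] F.1.obj (op V) :=
  (F.1.map (homOfLE h).op).hom

/-- A morphism of sheaves on sections over `U`, as a linear map. -/
def app {F F' : Shv k X} (f : F ⟶ F') (U : Opens X) : F.1.obj (op U) →ₗ[k] F'.1.obj (op U) :=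
  (f.1.app (op U)).hom

/-- The map induced on stalks, as a linear map. -/
noncomputable def stalkMap {F F' : Shv k X} (f : F ⟶ F') (x : X) : Stalk F x →ₗ[k] Stalk F' x :=
  ((TopCat.Presheaf.stalkFunctor (ModuleCat.{u} k) x).map f.1).hom

theorem germ_res (F : Shv k X) {U V : Opens X} (h : V ≤ U) (x : X) (hx : x ∈ V)
    (s : F.1.obj (op U)) : germ F V x hx (res F h s) = germ F U x (h hx) s :=
  TopCat.Presheaf.germ_res_apply F.1 (homOfLE h) x hx s

theorem res_res (F : Shv k X) {U V W : Opens X} (h : V ≤ U) (h' : W ≤ V) (s : F.1.obj (op U)) :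
    res F h' (res F h s) = res F (h'.trans h) s := by
  have : F.1.map (homOfLE (h'.trans h)).op = F.1.map (homOfLE h).op ≫ F.1.map (homOfLE h').op := by
    rw [← F.1.map_comp]; rfl
  exact (congrArg (fun a => a.hom s) this).symm

theorem app_res {F F' : Shv k X} (f : F ⟶ F') {U V : Opens X} (h : V ≤ U) (s : F.1.obj (op U)) :
    app f V (res F h s) = res F' h (app f U s) :=
  congrArg (fun a => a.hom s) (f.1.naturality (homOfLE h).op)

theorem stalkMap_germ {F F' : Shv k X} (f : F ⟶ F') (U : Opens X) (x : X) (hx : x ∈ U)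
    (s : F.1.obj (op U)) : stalkMap f x (germ F U x hx s) = germ F' U x hx (app f U s) :=
  TopCat.Presheaf.stalkFunctor_map_germ_apply U x hx f.1 s

theorem exists_germ (F : Shv k X) {x : X} (a : Stalk F x) :
    ∃ (U : Opens X) (hx : x ∈ U) (s : F.1.obj (op U)), germ F U x hx s = a :=
  TopCat.Presheaf.exists_germ_eq F.1 a

theorem exists_res_eq_res (F : Shv k X) {U V : Opens X} {x : X} (hU : x ∈ U) (hV : x ∈ V)
    (s : F.1.obj (op U)) (t : F.1.obj (op V)) (h : germ F U x hU s = germ F V x hV t) :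
    ∃ (W : Opens X) (_ : x ∈ W) (hWU : W ≤ U) (hWV : W ≤ V), res F hWU s = res F hWV t := by
  obtain ⟨W, hx, iU, iV, h⟩ := TopCat.Presheaf.germ_eq F.1 x hU hV s t h
  exact ⟨W, hx, iU.le, iV.le, h⟩

theorem section_ext (F : Shv k X) {U : Opens X} {s t : F.1.obj (op U)}
    (h : ∀ (x : X) (hx : x ∈ U), germ F U x hx s = germ F U x hx t) : s = t :=
  TopCat.Presheaf.section_ext F U s t h

/-- A family of elements of the stalks that is locally given by sections is given by a section. -/
theorem exists_section (F : Shv k X) {U : Opens X} (a : ∀ x ∈ U, Stalk F x)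
    (h : ∀ x ∈ U, ∃ (V : Opens X) (_ : x ∈ V) (s : F.1.obj (op V)),
      ∀ z (hz : z ∈ V) (hzU : z ∈ U), germ F V z hz s = a z hzU) :
    ∃ s : F.1.obj (op U), ∀ x hx, germ F U x hx s = a x hx := by
  choose V hxV s hs using h
  -- Intersecting with `U` gives a cover of `U` by subsets of `U`; on overlaps both sections have
  -- the germs `a z`, so they agree.
  obtain ⟨t, ht, -⟩ := TopCat.Sheaf.existsUnique_gluing' F
    (fun x : U => V x.1 x.2 ⊓ U) U (fun x => homOfLE inf_le_right)
    (fun x hx => Opens.mem_iSup.2 ⟨⟨x, hx⟩, hxV x hx, hx⟩)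
    (fun x => res F inf_le_left (s x.1 x.2)) (by
      intro x y
      apply section_ext F
      intro z hz
      refine (germ_res F (inf_le_left : (V x.1 x.2 ⊓ U) ⊓ (V y.1 y.2 ⊓ U) ≤ _) z hz _).trans ?_
      refine Eq.trans ?_
        (germ_res F (inf_le_right : (V x.1 x.2 ⊓ U) ⊓ (V y.1 y.2 ⊓ U) ≤ _) z hz _).symm
      rw [germ_res, germ_res, hs _ _ _ _ hz.1.2, hs _ _ _ _ hz.1.2])
  refine ⟨t, fun x hx => ?_⟩
  have h1 := germ_res F (inf_le_right : V x hx ⊓ U ≤ U) x ⟨hxV x hx, hx⟩ t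
  rw [← h1, ← hs x hx x (hxV x hx) hx, ← germ_res F inf_le_left x ⟨hxV x hx, hx⟩]
  exact congrArg _ (ht ⟨x, hx⟩)

theorem hom_ext_stalk {F F' : Shv k X} {f g : F ⟶ F'}
    (h : ∀ (U : Opens X) (x : X) (hx : x ∈ U) (s : F.1.obj (op U)),
      stalkMap f x (germ F U x hx s) = stalkMap g x (germ F U x hx s)) : f = g := by
  apply Sheaf.hom_ext
  apply NatTrans.ext
  funext U
  apply ModuleCat.hom_ext
  apply LinearMap.ext
  intro s
  apply section_ext F'
  intro x hx
  have := h U.unop x hx s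
  rwa [stalkMap_germ, stalkMap_germ] at this

/-- A family of linear maps of the stalks that respects local sections is induced by a morphism. -/
theorem exists_hom {F F' : Shv k X} (a : ∀ x, Stalk F x →ₗ[k] Stalk F' x)
    (h : ∀ (U : Opens X) (s : F.1.obj (op U)), ∀ x ∈ U,
      ∃ (V : Opens X) (_ : x ∈ V) (t : F'.1.obj (op V)),
        ∀ z (hz : z ∈ V) (hzU : z ∈ U), germ F' V z hz t = a z (germ F U z hzU s)) :
    ∃ f : F ⟶ F', ∀ x, stalkMap f x = a x := by
  have h' := fun (U : Opens X) (s : F.1.obj (op U)) =>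
    exists_section F' (fun x hx => a x (germ F U x hx s)) (h U s)
  choose b hb using h'
  -- Sections are determined by their germs, so the chosen `b` inherits linearity and naturality
  -- from `a`.
  let f : F ⟶ F' := ⟨{
    app U := ModuleCat.ofHom
      { toFun := b U.unop
        map_add' s t := section_ext F' fun x hx => by simp only [hb, map_add]
        map_smul' c s := section_ext F' fun x hx => by
          simp only [hb, map_smul, RingHom.id_apply] }
    naturality U V i := by
      apply ModuleCat.hom_ext
      apply LinearMap.ext
      intro s
      apply section_ext F'
      intro x hx
      refine (hb V.unop _ x hx).trans ?_
      refine Eq.trans ?_ (germ_res F' i.unop.le x hx (b U.unop s)).symm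
      rw [hb]
      exact congrArg (a x) (germ_res F i.unop.le x hx s) }⟩
  refine ⟨f, fun x => LinearMap.ext fun c => ?_⟩
  obtain ⟨U, hx, s, rfl⟩ := exists_germ F c
  rw [stalkMap_germ]
  exact hb U s x hx

theorem isIso_of_stalkMap_bijective {F F' : Shv k X} (f : F ⟶ F')
    (h : ∀ x, Function.Bijective (stalkMap f x)) : IsIso f := by
  have (x : X) : IsIso ((TopCat.Presheaf.stalkFunctor (ModuleCat.{u} k) x).map f.1) :=
    (ConcreteCategory.isIso_iff_bijective _).2 (h x)
  exact TopCat.Presheaf.isIso_of_stalkFunctor_map_iso f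

end Stalks

/-! ### Stalks and sections of the inverse image -/

section InverseImage

/-- The transports that cancel here come from the case distinction in the values of a skyscraper
presheaf. The objects are abstract so that `subst` applies. -/
theorem comp_eqToHom_comp_eqToHom {C : Type*} [Category* C] {A B D : C} (f : A ⟶ B) (h : B = D)
    (h' : D = B) : (f ≫ 𝟙 B ≫ eqToHom h) ≫ eqToHom h' = f ≫ 𝟙 B := by
  subst h
  simp

variable {X Y : TopCat.{u}} {φ : Y ⟶ X} {k : Type u} [Ring k]

open scoped Classical in
/-- The direct image of a skyscraper sheaf is the skyscraper sheaf at the image point. -/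
noncomputable def toPushSkyscraper (F : Shv k X) (y : Y) {M : ModuleCat.{u} k}
    (f : Stalk F (φ y) ⟶ M) : F ⟶ (push φ k).obj (skyscraperSheaf y M) :=
  -- The two targets agree by definition, since `y ∈ φ⁻¹ U` unfolds to `φ y ∈ U`.
  ⟨StalkSkyscraperPresheafAdjunctionAuxs.toSkyscraperPresheaf (φ y) f⟩

variable (φ) in
/-- The map `F_{φ y} ⟶ (φ⁻¹ F)_y` of stalks. -/
noncomputable def stalkUnit (F : Shv k X) (y : Y) : Stalk F (φ y) ⟶ Stalk ((pull φ k).obj F) y :=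
  (TopCat.Presheaf.stalkFunctor (ModuleCat.{u} k) (φ y)).map ((pullPushAdj φ k).unit.app F).1 ≫
    TopCat.Presheaf.stalkPushforward (ModuleCat.{u} k) φ ((pull φ k).obj F).1 y

theorem germ_stalkUnit (F : Shv k X) (y : Y) (U : Opens X) (hy : φ y ∈ U) :
    TopCat.Presheaf.germ (C := ModuleCat.{u} k) F.1 U (φ y) hy ≫ stalkUnit φ F y =
      unitApp F U ≫ TopCat.Presheaf.germ (C := ModuleCat.{u} k) ((pull φ k).obj F).1
        ((Opens.map φ).obj U) y hy := by
  have h1 := TopCat.Presheaf.stalkFunctor_map_germ U (φ y) hy ((pullPushAdj φ k).unit.app F).1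
  have h2 := TopCat.Presheaf.stalkPushforward_germ (ModuleCat.{u} k) φ ((pull φ k).obj F).1 U y hy
  exact (Category.assoc _ _ _).symm.trans ((congrArg (· ≫ TopCat.Presheaf.stalkPushforward
    (ModuleCat.{u} k) φ ((pull φ k).obj F).1 y) h1).trans ((Category.assoc _ _ _).trans
      (congrArg (unitApp F U ≫ ·) h2)))

/-- Maps from the stalk at `y` to `M` are morphisms from `φ⁻¹ F` to the skyscraper sheaf at `y`, and
by adjunction these are determined on sections coming from `F`. There only the composite with
`stalkUnit` is visible. -/
theorem stalkUnit_hom_ext {F : Shv k X} {y : Y} {M : ModuleCat.{u} k}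
    {a b : Stalk ((pull φ k).obj F) y ⟶ M} (h : stalkUnit φ F y ≫ a = stalkUnit φ F y ≫ b) :
    a = b := by
  classical
  let a' : (pull φ k).obj F ⟶ skyscraperSheaf y M :=
    ⟨StalkSkyscraperPresheafAdjunctionAuxs.toSkyscraperPresheaf y a⟩
  let b' : (pull φ k).obj F ⟶ skyscraperSheaf y M :=
    ⟨StalkSkyscraperPresheafAdjunctionAuxs.toSkyscraperPresheaf y b⟩
  have key : a' = b' := by
    apply pullback_hom_ext
    intro U
    by_cases hU : φ y ∈ U
    · have hU' : y ∈ (Opens.map φ).obj U := hU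
      have e (c : Stalk ((pull φ k).obj F) y ⟶ M) := congrArg (unitApp F U ≫ ·)
        ((StalkSkyscraperPresheafAdjunctionAuxs.toSkyscraperPresheaf_app y c
          (op ((Opens.map φ).obj U))).trans (dif_pos hU'))
      refine (e a).trans (Eq.trans ?_ (e b).symm)
      have e' (c : Stalk ((pull φ k).obj F) y ⟶ M) {N : ModuleCat.{u} k} (d : M ⟶ N) :
        unitApp F U ≫ TopCat.Presheaf.germ (C := ModuleCat.{u} k) ((pull φ k).obj F).1
          ((Opens.map φ).obj U) y hU' ≫ c ≫ d =
        TopCat.Presheaf.germ (C := ModuleCat.{u} k) F.1 U (φ y) hU ≫ (stalkUnit φ F y ≫ c) ≫ d :=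
        (Category.assoc _ _ _).symm.trans ((congrArg (· ≫ c ≫ d)
          (germ_stalkUnit F y U hU).symm).trans (by simp only [Category.assoc]))
      refine (e' a _).trans (Eq.trans ?_ (e' b _).symm)
      rw [h]
    · exact (isTerminalSkyscraperSheafObjObjOfNotMem (p₀ := y) (A := M)
        (U := op ((Opens.map φ).obj U)) hU).hom_ext _ _
  have h1 := congrArg (fun c => StalkSkyscraperPresheafAdjunctionAuxs.fromStalk y c.1) key
  exact (StalkSkyscraperPresheafAdjunctionAuxs.fromStalk_to_skyscraper y a).symm.trans
    (h1.trans (StalkSkyscraperPresheafAdjunctionAuxs.fromStalk_to_skyscraper y b))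

/-- The identity of `F_{φ y}` gives a morphism from `F` to the direct image of a skyscraper at `y`;
its transpose induces a retraction `r` on stalks. Since `stalkUnit` is also an epimorphism by
`stalkUnit_hom_ext`, `r` is a two-sided inverse. -/
instance isIso_stalkUnit (F : Shv k X) (y : Y) : IsIso (stalkUnit φ F y) := by
  classical
  let a : (pull φ k).obj F ⟶ skyscraperSheaf y (Stalk F (φ y)) :=
    ((pullPushAdj φ k).homEquiv _ _).symm (toPushSkyscraper F y (𝟙 _))
  let r : Stalk ((pull φ k).obj F) y ⟶ Stalk F (φ y) :=
    StalkSkyscraperPresheafAdjunctionAuxs.fromStalk y a.1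
  have hr : stalkUnit φ F y ≫ r = 𝟙 _ := by
    apply TopCat.Presheaf.stalk_hom_ext
    intro U hU
    rw [← Category.assoc, germ_stalkUnit, Category.assoc]
    refine (congrArg (unitApp F U ≫ ·)
      (StalkSkyscraperPresheafAdjunctionAuxs.germ_fromStalk y a.1 _ hU)).trans ?_
    have h1 : (pullPushAdj φ k).unit.app F ≫ (push φ k).map a = toPushSkyscraper F y (𝟙 _) :=
      ((pullPushAdj φ k).homEquiv_unit ..).symm.trans
        (((pullPushAdj φ k).homEquiv _ _).apply_symm_apply _)
    have h2 : unitApp F U ≫ a.1.app (op ((Opens.map φ).obj U)) =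
      (toPushSkyscraper F y (𝟙 _)).1.app (op U) := congrArg
        (fun (f : F ⟶ (push φ k).obj (skyscraperSheaf y (Stalk F (φ y)))) => f.1.app (op U)) h1
    have h3 : (toPushSkyscraper F y (𝟙 (Stalk F (φ y)))).1.app (op U) = _ :=
      (StalkSkyscraperPresheafAdjunctionAuxs.toSkyscraperPresheaf_app (φ y)
        (𝟙 (Stalk F (φ y))) (op U)).trans (dif_pos hU)
    refine (Category.assoc _ _ _).symm.trans
      ((congrArg (· ≫ eqToHom (if_pos hU)) (h2.trans h3)).trans ?_)
    exact comp_eqToHom_comp_eqToHom _ _ _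
  refine ⟨r, hr, stalkUnit_hom_ext ?_⟩
  rw [← Category.assoc, hr, Category.id_comp, Category.comp_id]

variable (φ) in
/-- The identification `F_x ≅ (φ⁻¹ F)_y` of stalks, for `φ y = x`. -/
noncomputable def stalkEquiv (F : Shv k X) (y : Y) {x : X} (h : φ y = x) :
    Stalk F x ≃ₗ[k] Stalk ((pull φ k).obj F) y := by
  subst h
  exact (asIso (stalkUnit φ F y)).toLinearEquiv

/-- Keeping `x` a variable with `φ y = x` lets the points `y` and `g y` of one fibre be compared in
the same stalk, without transport along `φ (g y) = φ y`. -/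
theorem stalkEquiv_germ (F : Shv k X) (y : Y) {x : X} (h : φ y = x) (U : Opens X) (hx : x ∈ U)
    (hy : y ∈ (Opens.map φ).obj U) (s : F.1.obj (op U)) :
    stalkEquiv φ F y h (germ F U x hx s) =
      germ ((pull φ k).obj F) ((Opens.map φ).obj U) y hy ((unitApp F U).hom s) := by
  subst h
  exact congrArg (fun a => a.hom s) (germ_stalkUnit F y U hx)

/-- The value in `F_x`, `x = φ y`, at the point `y` of a section of `φ⁻¹ F`. -/
noncomputable def value {F : Shv k X} {V : Opens Y} (y : Y) (hy : y ∈ V) {x : X} (h : φ y = x) :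
    ((pull φ k).obj F).1.obj (op V) →ₗ[k] Stalk F x :=
  (stalkEquiv φ F y h).symm.toLinearMap ∘ₗ germ ((pull φ k).obj F) V y hy

variable {F : Shv k X}

theorem stalkEquiv_value {V : Opens Y} (y : Y) (hy : y ∈ V) {x : X} (h : φ y = x)
    (s : ((pull φ k).obj F).1.obj (op V)) :
    stalkEquiv φ F y h (value y hy h s) = germ ((pull φ k).obj F) V y hy s :=
  (stalkEquiv φ F y h).apply_symm_apply _

theorem value_eq_iff {V W : Opens Y} {y : Y} {hV : y ∈ V} {hW : y ∈ W} {x : X} {h : φ y = x}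
    {s : ((pull φ k).obj F).1.obj (op V)} {t : ((pull φ k).obj F).1.obj (op W)} :
    value y hV h s = value y hW h t ↔
      germ ((pull φ k).obj F) V y hV s = germ ((pull φ k).obj F) W y hW t :=
  (stalkEquiv φ F y h).symm.injective.eq_iff

theorem value_unitApp (U : Opens X) (y : Y) (hy : y ∈ (Opens.map φ).obj U) {x : X} (hx : x ∈ U)
    (h : φ y = x) (s : F.1.obj (op U)) :
    value y hy h ((unitApp F U).hom s) = germ F U x hx s :=
  (stalkEquiv φ F y h).injective <| by rw [stalkEquiv_value, stalkEquiv_germ F y h U hx hy]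

theorem value_res {V W : Opens Y} (hWV : W ≤ V) (y : Y) (hy : y ∈ W) {x : X} (h : φ y = x)
    (s : ((pull φ k).obj F).1.obj (op V)) :
    value y hy h (res _ hWV s) = value y (hWV hy) h s :=
  value_eq_iff.2 (germ_res _ _ _ _ _)

theorem value_ext {V : Opens Y} {s t : ((pull φ k).obj F).1.obj (op V)}
    (h : ∀ y (hy : y ∈ V), value y hy rfl s = value y hy rfl t) : s = t :=
  section_ext _ fun y hy => value_eq_iff.1 (h y hy)

/-- A section of `φ⁻¹ F` is locally the inverse image of a section of `F`. -/
theorem exists_res_eq_res_unitApp {V : Opens Y} (s : ((pull φ k).obj F).1.obj (op V)) (y : Y)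
    (hy : y ∈ V) : ∃ (U : Opens X) (t : F.1.obj (op U)) (W : Opens Y) (_ : y ∈ W) (hWV : W ≤ V)
      (hWU : W ≤ (Opens.map φ).obj U), res _ hWV s = res _ hWU ((unitApp F U).hom t) := by
  obtain ⟨U, hU, t, ht⟩ := exists_germ F (value y hy rfl s)
  obtain ⟨W, hyW, hWV, hWU, h⟩ := exists_res_eq_res ((pull φ k).obj F) hy
    (show y ∈ (Opens.map φ).obj U from hU) s ((unitApp F U).hom t) (by
      rw [← stalkEquiv_germ F y rfl U hU hU, ht, stalkEquiv_value])
  exact ⟨U, t, W, hyW, hWV, hWU, h⟩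

theorem exists_value_eq_germ {V : Opens Y} (s : ((pull φ k).obj F).1.obj (op V)) (y : Y)
    (hy : y ∈ V) : ∃ (U : Opens X) (t : F.1.obj (op U)) (W : Opens Y) (_ : y ∈ W) (hWV : W ≤ V)
      (_ : W ≤ (Opens.map φ).obj U), ∀ z (hz : z ∈ W) {x : X} (h : φ z = x) (hx : x ∈ U),
        value z (hWV hz) h s = germ F U x hx t := by
  obtain ⟨U, t, W, hyW, hWV, hWU, e⟩ := exists_res_eq_res_unitApp s y hy
  refine ⟨U, t, W, hyW, hWV, hWU, fun z hz x h hx => ?_⟩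
  rw [← value_res hWV z hz h, e, value_res, value_unitApp U z (hWU hz) hx h]

/-- A family of values that is locally given by sections of `F` is given by a section of
`φ⁻¹ F`. -/
theorem exists_value_eq {V : Opens Y} (a : ∀ y ∈ V, Stalk F (φ y))
    (h : ∀ y ∈ V, ∃ (U : Opens X) (t : F.1.obj (op U)) (W : Opens Y) (_ : y ∈ W),
      ∀ z (_ : z ∈ W) (hzV : z ∈ V), ∃ hz : φ z ∈ U, a z hzV = germ F U (φ z) hz t) :
    ∃ s : ((pull φ k).obj F).1.obj (op V), ∀ y hy, value y hy rfl s = a y hy := by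
  obtain ⟨s, hs⟩ := exists_section ((pull φ k).obj F) (U := V)
    (fun y hy => stalkEquiv φ F y rfl (a y hy)) (by
      intro y hy
      obtain ⟨U, t, W, hyW, e⟩ := h y hy
      obtain ⟨hyU, -⟩ := e y hyW hy
      refine ⟨W ⊓ (Opens.map φ).obj U, ⟨hyW, hyU⟩, res _ inf_le_right ((unitApp F U).hom t), ?_⟩
      intro z hz hzV
      obtain ⟨hzU, e⟩ := e z hz.1 hzV
      rw [e, stalkEquiv_germ F z rfl U hzU hzU, germ_res])
  exact ⟨s, fun y hy => (stalkEquiv φ F y rfl).injective ((stalkEquiv_value ..).trans (hs y hy))⟩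

/-- This is `(s ∘ g)(y) = s(g y)`: the action defined through the adjunction is the geometric one.
Locally `s` is the inverse image of a section of `F`, on which pull-back by `g` is mere restriction
by `unit_deckPull`. -/
theorem value_deckPullApp (g : Deck φ) {V : Opens Y} (s : ((pull φ k).obj F).1.obj (op V)) (y : Y)
    (hy : y ∈ (Opens.map (deckHom φ g)).obj V) {x : X} (h : φ y = x) :
    value y hy h ((deckPullApp g F V).hom s) = value (g.1 y) hy ((g.2 y).trans h) s := by
  obtain ⟨U, t, W, hyW, hWV, hWU, e⟩ := exists_res_eq_res_unitApp s (g.1 y) hy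
  have hx : x ∈ U := by
    have h1 : φ (g.1 y) ∈ U := hWU hyW
    rwa [g.2 y, h] at h1
  have nat {V V' : Opens Y} (hV : V' ≤ V) (s : ((pull φ k).obj F).1.obj (op V)) :
      (deckPullApp g F V').hom (res _ hV s) =
        res ((pull φ k).obj F) (U := (Opens.map (deckHom φ g)).obj V)
          (V := (Opens.map (deckHom φ g)).obj V') (fun z hz => hV hz)
          ((deckPullApp g F V).hom s) :=
    app_res (deckPull φ k g F) hV s
  have hy' : y ∈ (Opens.map (deckHom φ g)).obj W := hyW
  have hr (V : Opens Y) (hV : W ≤ V) (s : ((pull φ k).obj F).1.obj (op V)) :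
      value y (show y ∈ (Opens.map (deckHom φ g)).obj V from hV (show g.1 y ∈ W from hyW)) h ((deckPullApp g F V).hom s) =
        value y hy' h ((deckPullApp g F W).hom (res _ hV s)) := by
    rw [nat hV]
    exact (value_res (V := (Opens.map (deckHom φ g)).obj V)
      (W := (Opens.map (deckHom φ g)).obj W) (fun z (hz : g.1 z ∈ W) => hV hz) y hy' h _).symm
  rw [hr V hWV, e, ← hr _ hWU, ← value_res hWV _ hyW, e, value_res, value_unitApp U _ (hWU hyW) hx]
  have h2 := congrArg (fun a => a.hom t) (unit_deckPull φ k g F U)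
  have h3 : (deckPullApp g F ((Opens.map φ).obj U)).hom ((unitApp F U).hom t) =
    res _ (preimage_deckHom_le g U) ((unitApp F U).hom t) := h2
  rw [h3, value_res, value_unitApp U y (show φ y ∈ U from h ▸ hx) hx]

theorem value_pullApp {F' : Shv k X} (f : F ⟶ F') {V : Opens Y}
    (s : ((pull φ k).obj F).1.obj (op V)) (y : Y) (hy : y ∈ V) {x : X} (h : φ y = x) :
    value y hy h ((pullApp f V).hom s) = stalkMap f x (value y hy h s) := by
  obtain ⟨U, t, W, hyW, hWV, hWU, e⟩ := exists_res_eq_res_unitApp s y hy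
  have hx : x ∈ U := h ▸ hWU hyW
  have nat {V V' : Opens Y} (hV : V' ≤ V) (s : ((pull φ k).obj F).1.obj (op V)) :
      (pullApp f V').hom (res _ hV s) = res _ hV ((pullApp f V).hom s) :=
    app_res ((pull φ k).map f) hV s
  rw [← value_res hWV y hyW, ← nat, ← value_res hWV y hyW, e, nat, value_res, value_res,
    value_unitApp U _ (hWU hyW) hx, stalkMap_germ]
  have h2 := congrArg (fun a => a.hom t) (unitApp_naturality φ k f U)
  have h3 : (pullApp (φ := φ) f ((Opens.map φ).obj U)).hom ((unitApp F U).hom t) =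
    (unitApp F' U).hom (app f U t) := h2
  rw [h3, value_unitApp U _ (hWU hyW) hx]

end InverseImage

/-! ### Global sections of the inverse image as functions on the covering -/

section GlobalValues

variable {X Y : TopCat.{u}} {φ : Y ⟶ X} {k : Type u} [Ring k]

theorem Fibre.mk_congr {E : Rep.{u} k (Deck φ)} {x : X} {y z : Y} (h : y = z) (hy : φ y = x) (hz : φ z = x) (e : E) :
    Fibre.mk y hy e = Fibre.mk z hz e := by
  subst h
  rfl

variable {F : Shv k X}

variable (φ) in
/-- The value at `y` of a global section of `φ⁻¹ F`. -/
noncomputable def globalValue (y : Y) {x : X} (h : φ y = x) :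
    (sectionsRep φ k).obj F →ₗ[k] Stalk F x :=
  value (V := ⊤) y trivial h

theorem globalValue_ext {s t : (sectionsRep φ k).obj F}
    (h : ∀ y, globalValue φ y rfl s = globalValue φ y rfl t) : s = t :=
  value_ext fun y _ => h y

theorem globalValue_rho (g : Deck φ) (s : (sectionsRep φ k).obj F) (y : Y) {x : X} (h : φ y = x) :
    globalValue φ y h (((sectionsRep φ k).obj F).ρ g s) =
      globalValue φ ((g⁻¹).1 y) (((g⁻¹).2 y).trans h) s :=
  value_deckPullApp g⁻¹ s y trivial h

theorem globalValue_map {F' : Shv k X} (f : F ⟶ F') (s : (sectionsRep φ k).obj F) (y : Y) {x : X}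
    (h : φ y = x) : globalValue φ y h (((sectionsRep φ k).map f).hom s) =
      stalkMap f x (globalValue φ y h s) :=
  value_pullApp f s y trivial h

end GlobalValues

/-! ### Local sections and stalks of the associated sheaf -/

section LocalSections

variable {X Y : TopCat.{u}} (φ : Y ⟶ X) [IsUniversalCovering φ]

theorem exists_injOn (y : Y) : ∃ V : Opens Y, y ∈ V ∧ Set.InjOn φ V := by
  have hφ : IsCoveringMap φ := IsUniversalCovering.isCoveringMap
  obtain ⟨f, hf, hf'⟩ := hφ.isLocalHomeomorph y
  exact ⟨⟨f.source, f.open_source⟩, hf, hf' ▸ f.injOn⟩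

/-- The image of an open set under a universal covering. -/
def image (V : Opens Y) : Opens X :=
  ⟨φ '' V, (IsUniversalCovering.isCoveringMap (φ := φ)).isOpenMap V V.isOpen⟩

variable {φ} {k : Type u} [Ring k] {E : Rep.{u} k (Deck φ)}

theorem mem_image_of_mem {V : Opens Y} {y : Y} (hy : y ∈ V) : φ y ∈ image φ V := ⟨y, hy, rfl⟩

variable [ConnectedSpace X]

variable (E) in
/-- The sections `φ z ↦ [z, e]` over `φ V`, for `φ` injective on `V`. -/
noncomputable def localSection (V : Opens Y) (hV : Set.InjOn φ V) :
    E →ₗ[k] ((assocFunctor φ k).obj E).1.obj (op (image φ V)) where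
  toFun e := ⟨fun x => Fibre.mk x.2.choose x.2.choose_spec.2 e, by
    refine (continuous_iff (image φ V) _).2 ?_
    rintro y ⟨y', hy', h⟩
    -- Continuity has to be tested at every point over `φ V`, not only in `V`. At `g y'` with `y' ∈
    -- V` the constant label is `g e`, since `[g⁻¹ z, e] = [z, g e]`.
    obtain ⟨g, rfl⟩ := exists_deck φ h
    refine ⟨E.ρ g e, ?_⟩
    have hV' : (g⁻¹ : Deck φ).1 ⁻¹' V ∈ 𝓝 (g.1 y') :=
      (V.isOpen.preimage (g⁻¹ : Deck φ).1.continuous).mem_nhds (by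
        change g.1.symm (g.1 y') ∈ V
        rwa [g.1.symm_apply_apply])
    filter_upwards [hV'] with z hz hzU
    have h1 : hzU.choose = g.1.symm z := hV hzU.choose_spec.1 hz
      (hzU.choose_spec.2.trans ((g⁻¹).2 z).symm)
    refine (Fibre.mk_congr h1 _ ((g⁻¹).2 z) e).trans ?_
    exact Fibre.ext (AssocSpace.mk_eq_mk.2 ⟨g, g.1.apply_symm_apply z, rfl⟩)⟩
  map_add' e f := Subtype.ext (funext fun x => Fibre.mk_add _ _ e f)
  map_smul' c e := Subtype.ext (funext fun x => Fibre.mk_smul _ _ c e)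

theorem localSection_apply (V : Opens Y) (hV : Set.InjOn φ V) (e : E) {z : Y} (hz : z ∈ V) {x : X}
    (h : φ z = x) (hx : x ∈ image φ V) :
    (localSection E V hV e).1 ⟨x, hx⟩ = Fibre.mk z h e :=
  Fibre.mk_congr (hV hx.choose_spec.1 hz (hx.choose_spec.2.trans h.symm)) _ _ e

/-- The germ of a section of `𝓛_E` at `x` is determined by its value at `x`. -/
theorem germ_eq_germ_iff {U V : Opens X} {x : X} (hU : x ∈ U) (hV : x ∈ V)
    (s : ((assocFunctor φ k).obj E).1.obj (op U)) (t : ((assocFunctor φ k).obj E).1.obj (op V)) :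
    germ ((assocFunctor φ k).obj E) U x hU s = germ ((assocFunctor φ k).obj E) V x hV t ↔
      s.1 ⟨x, hU⟩ = t.1 ⟨x, hV⟩ := by
  constructor
  · intro h
    obtain ⟨W, hx, hWU, hWV, h⟩ := exists_res_eq_res _ hU hV s t h
    exact congrArg (fun (a : ((assocFunctor φ k).obj E).1.obj (op W)) => a.1 ⟨x, hx⟩) h
  · intro h
    have hφ : IsCoveringMap φ := IsUniversalCovering.isCoveringMap
    obtain ⟨y, rfl⟩ := surjective φ x
    obtain ⟨e, he⟩ := (Fibre.mk_bijective φ E y rfl).2 (s.1 ⟨φ y, hU⟩)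
    -- Near `y` both sections are `φ z ↦ [z, e]` with the same `e`.
    have hs := (continuousAt_iff U s.1 y hU e he.symm).1 s.2.continuousAt
    have ht := (continuousAt_iff V t.1 y hV e (h ▸ he.symm)).1 t.2.continuousAt
    have hst : ∀ᶠ x in 𝓝 (φ y), ∀ (hxU : x ∈ U) (hxV : x ∈ V), s.1 ⟨x, hxU⟩ = t.1 ⟨x, hxV⟩ := by
      rw [← hφ.isLocalHomeomorph.map_nhds_eq, Filter.eventually_map]
      filter_upwards [hs, ht] with z hsz htz hzU hzV
      rw [hsz, htz]
    obtain ⟨W, hW, hWo, hyW⟩ := eventually_nhds_iff.1 hst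
    let W' : Opens X := ⟨W, hWo⟩ ⊓ (U ⊓ V)
    have hW'U : W' ≤ U := inf_le_right.trans inf_le_left
    have hW'V : W' ≤ V := inf_le_right.trans inf_le_right
    have key : res ((assocFunctor φ k).obj E) hW'U s = res ((assocFunctor φ k).obj E) hW'V t :=
      Subtype.ext (funext fun x => hW x.1 x.2.1 (hW'U x.2) (hW'V x.2))
    have hyW' : φ y ∈ W' := ⟨hyW, hU, hV⟩
    rw [← germ_res _ hW'U _ hyW', key, germ_res]

/-- The element of the stalk of `𝓛_E` at `x = φ y` given by `[y, e]`. -/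
noncomputable def stalkMk (y : Y) {x : X} (h : φ y = x) : E →ₗ[k] Stalk ((assocFunctor φ k).obj E) x :=
  germ ((assocFunctor φ k).obj E) (image φ (exists_injOn φ y).choose) x
      (h ▸ mem_image_of_mem (exists_injOn φ y).choose_spec.1) ∘ₗ
    localSection E (exists_injOn φ y).choose (exists_injOn φ y).choose_spec.2

/-- Equalities in the stalk become equalities in the fibre, so the neighbourhood chosen in `stalkMk`
plays no further role. -/
theorem germ_eq_stalkMk_iff {U : Opens X} {y : Y} {x : X} (h : φ y = x) (hx : x ∈ U)
    (s : ((assocFunctor φ k).obj E).1.obj (op U)) (e : E) :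
    germ ((assocFunctor φ k).obj E) U x hx s = stalkMk y h e ↔ s.1 ⟨x, hx⟩ = Fibre.mk y h e := by
  refine (germ_eq_germ_iff hx _ s _).trans ?_
  rw [localSection_apply _ _ e (exists_injOn φ y).choose_spec.1 h]

theorem stalkMk_eq_stalkMk_iff {y z : Y} {x : X} (hy : φ y = x) (hz : φ z = x) (e f : E) :
    stalkMk y hy e = stalkMk z hz f ↔ Fibre.mk y hy e = Fibre.mk z hz f := by
  refine (germ_eq_stalkMk_iff hz _ _ f).trans ?_
  rw [localSection_apply _ _ e (exists_injOn φ y).choose_spec.1 hy]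

theorem stalkMk_bijective (y : Y) {x : X} (h : φ y = x) :
    Function.Bijective (stalkMk (E := E) y h) := by
  refine ⟨fun e f hef => ?_, fun a => ?_⟩
  · exact (Fibre.mk_bijective φ E y h).1 ((stalkMk_eq_stalkMk_iff h h e f).1 hef)
  · obtain ⟨U, hx, s, rfl⟩ := exists_germ _ a
    obtain ⟨e, he⟩ := (Fibre.mk_bijective φ E y h).2 (s.1 ⟨x, hx⟩)
    exact ⟨e, ((germ_eq_stalkMk_iff h hx s e).2 he.symm).symm⟩

theorem stalkMk_deck (g : Deck φ) (y : Y) {x : X} (h : φ y = x) (e : E) :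
    stalkMk (g.1 y) ((g.2 y).trans h) (E.ρ g e) = stalkMk y h e :=
  ((stalkMk_eq_stalkMk_iff h _ _ _).2 (Fibre.ext (AssocSpace.mk_eq_mk.2 ⟨g, rfl, rfl⟩))).symm

theorem stalkMk_deck_apply (g : Deck φ) (y : Y) {x : X} (h : φ y = x) (e : E) :
    stalkMk (g.1 y) ((g.2 y).trans h) e = stalkMk y h (E.ρ g⁻¹ e) := by
  rw [← stalkMk_deck g y h, ← Module.End.mul_apply, ← map_mul, mul_inv_cancel, map_one]
  rfl

theorem germ_localSection (V : Opens Y) (hV : Set.InjOn φ V) (e : E) {z : Y} (hz : z ∈ V) {x : X}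
    (h : φ z = x) (hx : x ∈ image φ V) :
    germ ((assocFunctor φ k).obj E) (image φ V) x hx (localSection E V hV e) = stalkMk z h e :=
  (germ_eq_stalkMk_iff h hx _ e).2 (localSection_apply V hV e hz h hx)

theorem stalkMap_assocFunctor {E' : Rep.{u} k (Deck φ)} (f : E ⟶ E') (y : Y) {x : X} (h : φ y = x)
    (e : E) : stalkMap ((assocFunctor φ k).map f) x (stalkMk y h e) = stalkMk y h (f.hom e) := by
  obtain ⟨U, hx, s, hs⟩ := exists_germ _ (stalkMk y h e)
  rw [← hs]
  refine (stalkMap_germ ((assocFunctor φ k).map f) U x hx s).trans ?_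
  have h1 := (germ_eq_stalkMk_iff h hx s e).1 hs
  refine (germ_eq_stalkMk_iff h hx _ _).2 ?_
  exact (congrArg (Fibre.map f) h1).trans (Fibre.map_mk f y h e)

end LocalSections

/-! ### The adjunction between associated sheaves and global sections on the covering -/

section Adjunction

variable {X Y : TopCat.{u}} (φ : Y ⟶ X) [IsUniversalCovering φ] [ConnectedSpace X]
  {k : Type u} [Ring k] (E : Rep.{u} k (Deck φ)) (F : Shv k X)

/-- On an open set where `φ` is injective, `y ↦ [y, e]` is the inverse image of `localSection`. -/
theorem exists_globalValue_eq (e : E) :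
    ∃ s : (sectionsRep φ k).obj ((assocFunctor φ k).obj E),
      ∀ (y : Y) (x : X) (h : φ y = x), globalValue φ y h s = stalkMk y h e := by
  obtain ⟨s, hs⟩ := exists_value_eq (φ := φ) (F := (assocFunctor φ k).obj E) (V := ⊤)
    (fun y _ => stalkMk y rfl e) (by
      intro y _
      obtain ⟨V, hyV, hV⟩ := exists_injOn φ y
      exact ⟨image φ V, localSection E V hV e, V, hyV, fun z hz _ =>
        ⟨mem_image_of_mem hz, (germ_localSection V hV e hz rfl _).symm⟩⟩)
  refine ⟨s, ?_⟩
  rintro y _ rfl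
  exact hs y trivial

/-- The unit `E ⟶ Γ(Y, φ⁻¹ 𝓛_E)`, which sends `e` to the section `y ↦ [y, e]`. -/
noncomputable def unitRep : E ⟶ (sectionsRep φ k).obj ((assocFunctor φ k).obj E) :=
  Rep.ofHom ⟨{
    toFun e := (exists_globalValue_eq φ E e).choose
    map_add' e f := globalValue_ext fun y => by
      refine Eq.trans ?_ (map_add (globalValue φ y rfl) _ _).symm
      refine ((exists_globalValue_eq φ E _).choose_spec y _ rfl).trans ?_
      simp only [(exists_globalValue_eq φ E _).choose_spec, map_add]
    map_smul' c e := globalValue_ext fun y => by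
      refine Eq.trans ?_ (map_smul (globalValue φ y rfl) _ _).symm
      refine ((exists_globalValue_eq φ E _).choose_spec y _ rfl).trans ?_
      simp only [(exists_globalValue_eq φ E _).choose_spec, map_smul, RingHom.id_apply] },
    fun g => LinearMap.ext fun e => globalValue_ext fun y => by
      refine ((exists_globalValue_eq φ E _).choose_spec y _ rfl).trans ?_
      refine Eq.trans ?_ (globalValue_rho g _ y rfl).symm
      refine Eq.trans ?_ ((exists_globalValue_eq φ E e).choose_spec _ _ _).symm
      -- Equivariance amounts to `[g⁻¹ y, e] = [y, g e]`.
      rw [stalkMk_deck_apply, inv_inv]⟩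

theorem globalValue_unitRep (e : E) (y : Y) {x : X} (h : φ y = x) :
    globalValue φ y h ((unitRep φ E).hom e) = stalkMk y h e :=
  (exists_globalValue_eq φ E e).choose_spec y x h

theorem unitRep_naturality {E E' : Rep.{u} k (Deck φ)} (f : E ⟶ E') :
    unitRep φ E ≫ (sectionsRep φ k).map ((assocFunctor φ k).map f) = f ≫ unitRep φ E' := by
  apply Rep.hom_ext
  apply Representation.IntertwiningMap.ext
  apply LinearMap.ext
  intro e
  refine globalValue_ext fun y => ?_
  refine (globalValue_map _ _ y rfl).trans ?_
  refine Eq.trans ?_ (globalValue_unitRep φ E' (f.hom e) y rfl).symm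
  exact (congrArg _ (globalValue_unitRep φ E e y rfl)).trans (stalkMap_assocFunctor f y rfl e)

variable {E F} in
/-- The map of stalks `[y, e] ↦ a(e)(y)` that belongs to `a : E ⟶ Γ(Y, φ⁻¹ F)`. -/
theorem exists_stalk_map (a : E ⟶ (sectionsRep φ k).obj F) (x : X) :
    ∃ c : Stalk ((assocFunctor φ k).obj E) x →ₗ[k] Stalk F x, ∀ (y : Y) (h : φ y = x) (e : E),
      c (stalkMk y h e) = globalValue φ y h (a.hom e) := by
  obtain ⟨y, rfl⟩ := surjective φ x
  let l := LinearEquiv.ofBijective _ (stalkMk_bijective (E := E) y rfl)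
  refine ⟨globalValue φ y rfl ∘ₗ a.hom.toLinearMap ∘ₗ l.symm.toLinearMap, fun z h e => ?_⟩
  -- Independence of the chosen `y` is equivariance of `a`: `[g y, e] = [y, g⁻¹ e]`, and `a(g⁻¹
  -- e)(y) = a(e)(g y)`.
  obtain ⟨g, rfl⟩ := exists_deck φ h.symm
  have h1 : l.symm (stalkMk (g.1 y) h e) = E.ρ g⁻¹ e := by
    rw [LinearEquiv.symm_apply_eq, stalkMk_deck_apply g y rfl]
    rfl
  change globalValue φ y rfl (a.hom (l.symm (stalkMk (g.1 y) h e))) = _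
  rw [h1, Rep.hom_comm_apply, globalValue_rho]
  simp only [inv_inv]

/-- The stalk maps respect sections: near `φ y` a section of `𝓛_E` is `φ z ↦ [z, e]` for a fixed
`e`, and `a(e)` is near `y` the inverse image of a section `t` of `F`, which serves as its image. -/
theorem exists_hom_stalkMk (a : E ⟶ (sectionsRep φ k).obj F) :
    ∃ f : (assocFunctor φ k).obj E ⟶ F, ∀ (y : Y) (x : X) (h : φ y = x) (e : E),
      stalkMap f x (stalkMk y h e) = globalValue φ y h (a.hom e) := by
  choose c hc using exists_stalk_map φ a
  obtain ⟨f, hf⟩ := exists_hom (F := (assocFunctor φ k).obj E) c (by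
    intro U s x hx
    obtain ⟨y, rfl⟩ := surjective φ x
    obtain ⟨e, he⟩ := (Fibre.mk_bijective φ E y rfl).2 (s.1 ⟨φ y, hx⟩)
    obtain ⟨V, hV, hVo, hyV⟩ := eventually_nhds_iff.1
      ((continuousAt_iff U s.1 y hx e he.symm).1 s.2.continuousAt)
    obtain ⟨U', t, W, hyW, _, hWU, ht⟩ :=
      exists_value_eq_germ (φ := φ) (F := F) (V := ⊤) (a.hom e) y trivial
    have hle : image φ (W ⊓ ⟨V, hVo⟩) ≤ U' := by
      rintro _ ⟨z, hz, rfl⟩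
      exact hWU hz.1
    refine ⟨_, mem_image_of_mem (V := W ⊓ ⟨V, hVo⟩) ⟨hyW, hyV⟩, res F hle t, ?_⟩
    rintro _ ⟨z, hz, rfl⟩ hzU
    refine (germ_res F hle (φ z) _ t).trans ?_
    rw [← ht z hz.1 rfl]
    refine (hc _ z rfl e).symm.trans (congrArg (c _) ?_)
    exact ((germ_eq_stalkMk_iff rfl hzU s e).2 (hV z hz.2 hzU)).symm)
  exact ⟨f, fun y x h e => by rw [hf, hc]⟩

variable {φ} {E F} in
theorem hom_ext_stalkMk {f g : (assocFunctor φ k).obj E ⟶ F}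
    (h : ∀ (y : Y) (e : E), stalkMap f (φ y) (stalkMk y rfl e) =
      stalkMap g (φ y) (stalkMk y rfl e)) : f = g := by
  apply hom_ext_stalk
  intro U x hx s
  obtain ⟨y, rfl⟩ := surjective φ x
  obtain ⟨e, he⟩ := (stalkMk_bijective y rfl).2 (germ ((assocFunctor φ k).obj E) U _ hx s)
  have := h y e
  rwa [he] at this

theorem globalValue_unitRep_comp (f : (assocFunctor φ k).obj E ⟶ F) (e : E) (y : Y) {x : X}
    (h : φ y = x) : globalValue φ y h ((unitRep φ E ≫ (sectionsRep φ k).map f).hom e) =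
      stalkMap f x (stalkMk y h e) :=
  (globalValue_map f _ y h).trans (congrArg _ (globalValue_unitRep φ E e y h))

/-- The universal property of the unit. The transpose of `f` records the values of `f` on all `[y,
e]`, and these exhaust the stalks; this gives injectivity, and `exists_hom_stalkMk` provides
preimages. -/
theorem unitRep_comp_bijective : Function.Bijective
    fun f : (assocFunctor φ k).obj E ⟶ F => unitRep φ E ≫ (sectionsRep φ k).map f := by
  refine ⟨fun f g h => hom_ext_stalkMk fun y e => ?_, fun a => ?_⟩
  · rw [← globalValue_unitRep_comp, ← globalValue_unitRep_comp]
    exact congrArg (fun (a : E ⟶ (sectionsRep φ k).obj F) => globalValue φ y rfl (a.hom e)) h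
  · obtain ⟨f, hf⟩ := exists_hom_stalkMk φ E F a
    refine ⟨f, ?_⟩
    apply Rep.hom_ext
    apply Representation.IntertwiningMap.ext
    apply LinearMap.ext
    intro e
    exact globalValue_ext fun y => (globalValue_unitRep_comp φ E F f e y rfl).trans (hf y _ rfl e)

/-- The functor `E ↦ 𝓛_E` is left adjoint to `F ↦ Γ(Y, φ⁻¹ F)`. -/
noncomputable def assocAdjunction (k : Type u) [Ring k] : assocFunctor φ k ⊣ sectionsRep φ k :=
  Adjunction.mkOfHomEquiv
    { homEquiv E F := Equiv.ofBijective _ (unitRep_comp_bijective φ E F)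
      homEquiv_naturality_left_symm f g := by
        rw [Equiv.symm_apply_eq]
        simp only [Equiv.ofBijective_apply, Functor.map_comp]
        rw [← Category.assoc, unitRep_naturality, Category.assoc]
        exact congrArg (f ≫ ·) ((Equiv.ofBijective _ (unitRep_comp_bijective φ _ _)).apply_symm_apply
          g).symm
      homEquiv_naturality_right f g := by
        simp only [Equiv.ofBijective_apply, Functor.map_comp, Category.assoc] }

theorem assocAdjunction_unit_app : (assocAdjunction φ k).unit.app E = unitRep φ E := by
  have h : (assocAdjunction φ k).homEquiv E _ (𝟙 _) =
    unitRep φ E ≫ (sectionsRep φ k).map (𝟙 _) := by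
      rw [assocAdjunction, Adjunction.mkOfHomEquiv_homEquiv]
      rfl
  rwa [Adjunction.homEquiv_id, (sectionsRep φ k).map_id, Category.comp_id] at h

/-- A global section of `φ⁻¹ 𝓛_E` has at each `y` the form `[y, d y]`. The label `d` is locally
constant by `continuousAt_iff`, hence constant because `Y` is connected. -/
theorem unitRep_bijective : Function.Bijective (unitRep φ E).hom := by
  have := (IsUniversalCovering.isSimplyConnected φ).connectedSpace
  obtain ⟨y₀⟩ : Nonempty Y := inferInstance
  refine ⟨fun e f h => (stalkMk_bijective y₀ rfl).1 ?_, fun s => ?_⟩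
  · rw [← globalValue_unitRep, ← globalValue_unitRep]
    exact congrArg _ h
  · choose d hd using fun y => (stalkMk_bijective (E := E) y rfl).2 (globalValue φ y rfl s)
    have hd' : IsLocallyConstant d := by
      rw [IsLocallyConstant.iff_exists_open]
      intro y
      obtain ⟨U, t, W, hyW, _, hWU, ht⟩ := exists_value_eq_germ (φ := φ)
        (F := (assocFunctor φ k).obj E) (V := ⊤) s y trivial
      have hy : t.1 ⟨φ y, hWU hyW⟩ = Fibre.mk y rfl (d y) :=
        (germ_eq_stalkMk_iff (E := E) (y := y) rfl (hWU hyW) t (d y)).1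
          ((ht y hyW rfl (hWU hyW)).symm.trans (hd y).symm)
      obtain ⟨V, hV, hVo, hyV⟩ := eventually_nhds_iff.1
        ((continuousAt_iff U t.1 y (hWU hyW) (d y) hy).1 t.2.continuousAt)
      refine ⟨W ∩ V, W.isOpen.inter hVo, ⟨hyW, hyV⟩, fun z hz => ?_⟩
      have h1 := ht z hz.1 rfl (hWU hz.1)
      have h2 := (germ_eq_stalkMk_iff (E := E) (y := z) rfl (hWU hz.1) t (d y)).2
        (hV z hz.2 (hWU hz.1))
      exact (stalkMk_bijective (E := E) z rfl).1 ((hd z).trans (h1.trans h2))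
    refine ⟨d y₀, globalValue_ext fun y => ?_⟩
    rw [globalValue_unitRep, ← hd y, hd'.apply_eq_of_preconnectedSpace y₀ y]

instance : IsIso (assocAdjunction φ k).unit := by
  have (E : Rep.{u} k (Deck φ)) : IsIso ((assocAdjunction φ k).unit.app E) := by
    rw [assocAdjunction_unit_app]
    have := (ConcreteCategory.isIso_iff_bijective (unitRep φ E)).2 (unitRep_bijective φ E)
    exact this
  exact NatIso.isIso_of_isIso_app _

/-- The functor `E ↦ 𝓛_E` is fully faithful. -/
noncomputable def assocFullyFaithful (k : Type u) [Ring k] : (assocFunctor φ k).FullyFaithful :=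
  (assocAdjunction φ k).fullyFaithfulLOfIsIsoUnit

end Adjunction

/-! ### Trivializations of a sheaf over an open set -/

section ConstantOn

variable {k : Type u} [Ring k] {X : TopCat.{u}}

/-- A linear map `c : M ⟶ F(U)` *trivializes* `F` on `U` if the sections of `F` on open subsets
of `U` are locally of the form `c m` for a unique `m`. -/
structure Trivializes {F : Shv k X} {U : Opens X} {M : Type u} [AddCommGroup M] [Module k M]
    (c : M →ₗ[k] F.1.obj (op U)) : Prop where
  eq_zero : ∀ (W : Opens X) (hW : W ≤ U), ∀ x ∈ W, ∀ m, res F hW (c m) = 0 → m = 0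
  exists_eq : ∀ (W : Opens X) (hW : W ≤ U) (s : F.1.obj (op W)), ∀ x ∈ W,
    ∃ (W' : Opens X) (hW' : W' ≤ W), x ∈ W' ∧ ∃ m, res F hW' s = res F (hW'.trans hW) (c m)

namespace Trivializes

variable {F F' : Shv k X} {U V : Opens X} {M : Type u} [AddCommGroup M] [Module k M]
  {c : M →ₗ[k] F.1.obj (op U)}

/-- Together with `of_germ_bijective` this characterizes trivializations by stalks. The definition
speaks of restrictions only, which makes it easy to compare on a space and on an open subspace. -/
theorem germ_bijective (h : Trivializes c) (x : X) (hx : x ∈ U) :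
    Function.Bijective fun m => germ F U x hx (c m) := by
  refine ⟨?_, fun a => ?_⟩
  · refine (injective_iff_map_eq_zero (germ F U x hx ∘ₗ c)).2 fun m hm => ?_
    obtain ⟨W, hxW, hW, _, e⟩ := exists_res_eq_res F hx hx (c m) 0
      (hm.trans (map_zero (germ F U x hx)).symm)
    exact h.eq_zero W hW x hxW m (e.trans (map_zero _))
  · obtain ⟨W, hxW, s, rfl⟩ := exists_germ F a
    obtain ⟨W', hW', hxW', m, hm⟩ := h.exists_eq (W ⊓ U) inf_le_right (res F inf_le_left s) x
      ⟨hxW, hx⟩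
    refine ⟨m, ?_⟩
    rw [res_res] at hm
    change germ F U x hx (c m) = _
    rw [← germ_res F (hW'.trans inf_le_right) x hxW', ← hm, germ_res]

theorem of_germ_bijective (h : ∀ x hx, Function.Bijective fun m => germ F U x hx (c m)) :
    Trivializes c where
  eq_zero W hW x hx m hm := (h x (hW hx)).1 <| by
    change germ F U x (hW hx) (c m) = germ F U x (hW hx) (c 0)
    rw [← germ_res F hW x hx, hm, map_zero, map_zero, map_zero]
  exists_eq W hW s x hx := by
    obtain ⟨m, hm⟩ := (h x (hW hx)).2 (germ F W x hx s)
    obtain ⟨W', hxW', hW', _, e⟩ := exists_res_eq_res F hx (hW hx) s (c m) hm.symm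
    exact ⟨W', hW', hxW', m, e⟩

theorem res (h : Trivializes c) (hV : V ≤ U) : Trivializes (res F hV ∘ₗ c) :=
  of_germ_bijective fun x hx => by
    simp only [LinearMap.comp_apply, germ_res]
    exact h.germ_bijective x (hV hx)

theorem comp_app (f : F ⟶ F')
    (hf : ∀ x, Function.Bijective (stalkMap f x)) (h : Trivializes c) :
    Trivializes (app f U ∘ₗ c) :=
  of_germ_bijective fun x hx => by
    simp only [LinearMap.comp_apply, ← stalkMap_germ]
    exact (hf x).comp (h.germ_bijective x hx)

end Trivializes

theorem stalkMap_bijective_of_isIso {F F' : Shv k X} (f : F ⟶ F') [IsIso f] (x : X) :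
    Function.Bijective (stalkMap f x) := by
  have := (TopCat.Presheaf.isIso_iff_stalkFunctor_map_iso f).1 ‹IsIso f› x
  exact (ConcreteCategory.isIso_iff_bijective _).1 this

end ConstantOn

/-! ### Constant sheaves -/

section ConstantSheaf

variable (k : Type u) [Ring k] (X : TopCat.{u})

/-- The constant sheaf functor. -/
noncomputable abbrev constSheaf : ModuleCat.{u} k ⥤ Shv k X :=
  constantSheaf (Opens.grothendieckTopology X) (ModuleCat.{u} k)

/-- The constant sheaf functor is left adjoint to the global sections functor. -/
noncomputable abbrev constSheafAdj :
    constSheaf k X ⊣ (sheafSections (Opens.grothendieckTopology X) (ModuleCat.{u} k)).obj (op ⊤) :=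
  constantSheafAdj _ _ isTerminalTop

variable {k}

/-- The constant sections of a constant sheaf. -/
noncomputable def constSection (M : ModuleCat.{u} k) :
    M →ₗ[k] ((constSheaf k X).obj M).1.obj (op ⊤) :=
  ((constSheafAdj k X).unit.app M).hom

/-- The constant sheaf is the sheafification of the constant presheaf. The two conditions are local
injectivity and local surjectivity of the map to the sheafification. -/
theorem trivializes_constSection (M : ModuleCat.{u} k) : Trivializes (constSection X M) := by
  let P : (Opens X)ᵒᵖ ⥤ ModuleCat.{u} k := (Functor.const _).obj M
  let J := Opens.grothendieckTopology X
  have key (W : Opens X) (m : M) : QuasiCoherator.res ((constSheaf k X).obj M) (le_top : W ≤ ⊤)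
      (constSection X M m) = ((toSheafify J P).app (op W)).hom m := by
    have h1 : constSection X M m = ((toSheafify J P).app (op ⊤)).hom m := by
      simp [constSection, constantSheafAdj, J, P]
      rfl
    rw [h1]
    exact congrArg (fun a => a.hom m)
      ((toSheafify J P).naturality (homOfLE (le_top : W ≤ ⊤)).op).symm
  constructor
  · intro W hW x hx m hm
    have h1 : ((toSheafify J P).app (op W)).hom m = ((toSheafify J P).app (op W)).hom 0 := by
      rw [← key W m, map_zero]; exact hm
    obtain ⟨V, i, hV, -⟩ := Presheaf.equalizerSieve_mem J (toSheafify J P) (X := op W) m (0 : M) h1 x hx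
    exact hV
  · intro W hW s x hx
    obtain ⟨V, i, ⟨m, hm⟩, hxV⟩ := Presheaf.imageSieve_mem J (toSheafify J P) (U := op W) s x hx
    refine ⟨V, i.le, hxV, m, ?_⟩
    rw [key V m]
    exact hm.symm

variable {X}

/-- A sheaf that is trivialized by global sections is constant. -/
theorem nonempty_iso_constSheaf {F : Shv k X} {M : ModuleCat.{u} k}
    {c : M →ₗ[k] F.1.obj (op ⊤)} (h : Trivializes c) : Nonempty (F ≅ (constSheaf k X).obj M) := by
  let f : (constSheaf k X).obj M ⟶ F :=
    ((constSheafAdj k X).homEquiv _ _).symm (ModuleCat.ofHom c)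
  have hf (m : M) : app f ⊤ (constSection X M m) = c m := by
    have h1 := ((constSheafAdj k X).homEquiv_unit ..).symm.trans
      (((constSheafAdj k X).homEquiv M F).apply_symm_apply (ModuleCat.ofHom c))
    exact congrArg (fun a => a.hom m) h1
  have := isIso_of_stalkMap_bijective f fun x => by
    have h1 : (stalkMap f x) ∘ (fun m => germ _ ⊤ x trivial (constSection X M m)) =
        fun m => germ F ⊤ x trivial (c m) := by
      funext m
      exact (stalkMap_germ f ⊤ x trivial _).trans (congrArg _ (hf m))
    have h2 := (trivializes_constSection X M).germ_bijective x trivial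
    have h3 := h.germ_bijective x trivial
    rw [← h1] at h3
    exact (Function.Bijective.of_comp_iff _ h2).1 h3
  exact ⟨(asIso f).symm⟩

end ConstantSheaf

/-! ### Restriction to open subspaces and local triviality -/

section Restriction

variable {k : Type u} [Ring k] {X : TopCat.{u}}

/-- An open subset of an open subspace as an open subset of the whole space. -/
def extend (U : Opens X) (W : Opens (TopCat.of U)) : Opens X :=
  ⟨Subtype.val '' (W : Set U), U.isOpen.isOpenMap_subtype_val W W.isOpen⟩

theorem extend_mono {U : Opens X} {W W' : Opens (TopCat.of U)} (h : W' ≤ W) :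
    extend U W' ≤ extend U W := Set.image_mono h

theorem extend_le (U : Opens X) (W : Opens (TopCat.of U)) : extend U W ≤ U := by
  rintro _ ⟨x, -, rfl⟩
  exact x.2

/-- The intersection with `U` as an open subset of `U`. -/
def trace (U V : Opens X) : Opens (TopCat.of U) :=
  ⟨Subtype.val ⁻¹' (V : Set X), V.isOpen.preimage continuous_subtype_val⟩

theorem extend_trace_le (U V : Opens X) : extend U (trace U V) ≤ V := by
  rintro _ ⟨x, hx, rfl⟩
  exact hx

theorem trace_le_of_le_extend {U V : Opens X} {W : Opens (TopCat.of U)} (h : V ≤ extend U W) :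
    trace U V ≤ W := by
  intro x hx
  obtain ⟨y, hy, e⟩ := h hx
  rwa [Subtype.ext e] at hy

/-- By definition the sections of `restrict U F` over `W` are those of `F` over `extend U W`; only
the open sets have to be moved back and forth, by `extend` and `trace`. -/
theorem trivializes_restrict_iff {F : Shv k X} {U : Opens X} {W : Opens (TopCat.of U)}
    {M : Type u} [AddCommGroup M] [Module k M] (c : M →ₗ[k] F.1.obj (op (extend U W))) :
    Trivializes (F := restrict U F) (U := W) c ↔ Trivializes c := by
  constructor
  · intro h
    constructor
    · intro V hV x hx m hm
      have hxW := hV hx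
      obtain ⟨x, hxW, rfl⟩ := hxW
      refine h.eq_zero (trace U V) (trace_le_of_le_extend hV) x hx m ?_
      have h1 : res F ((extend_trace_le U V).trans hV) (c m) = 0 := by
        rw [← res_res F hV (extend_trace_le U V), hm, map_zero]
      exact h1
    · intro V hV s x hx
      have hxW := hV hx
      obtain ⟨x, hxW, rfl⟩ := hxW
      obtain ⟨W', hW', hxW', m, hm⟩ := h.exists_eq (trace U V) (trace_le_of_le_extend hV)
        (res F (extend_trace_le U V) s) x hx
      refine ⟨extend U W', (extend_mono hW').trans (extend_trace_le U V), ⟨x, hxW', rfl⟩, m, ?_⟩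
      rw [← res_res F (extend_trace_le U V) (extend_mono hW')]
      exact hm
  · intro h
    constructor
    · intro V hV x hx m hm
      exact h.eq_zero (extend U V) (extend_mono hV) x ⟨x, hx, rfl⟩ m hm
    · intro V hV s x hx
      obtain ⟨W', hW', hxW', m, hm⟩ := h.exists_eq (extend U V) (extend_mono hV) s x ⟨x, hx, rfl⟩
      refine ⟨trace U W', trace_le_of_le_extend hW', hxW', m, ?_⟩
      have h1 := congrArg (res F (extend_trace_le U W')) hm
      exact ((res_res F hW' (extend_trace_le U W') s).symm.trans h1).trans (res_res F _ _ _)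

/-- A sheaf is *locally trivial* if it is trivialized on a neighbourhood of each point. -/
def IsLocallyTrivial (F : Shv k X) : Prop :=
  ∀ x : X, ∃ (U : Opens X) (_ : x ∈ U) (M : ModuleCat.{u} k) (c : M →ₗ[k] F.1.obj (op U)),
    Trivializes c

theorem IsLocallyTrivial.exists_restrict_iso {F : Shv k X} (h : IsLocallyTrivial F) (x : X) :
    ∃ U : Opens X, x ∈ U ∧ ∃ M : ModuleCat.{u} k,
      Nonempty (restrict U F ≅ (constSheaf k (TopCat.of U)).obj M) := by
  obtain ⟨U, hx, M, c, hc⟩ := h x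
  refine ⟨U, hx, M, ?_⟩
  -- The global sections of `restrict U F` are those of `F` over `extend U ⊤`, which is not
  -- definitionally `U`; hence `c` is first restricted.
  exact nonempty_iso_constSheaf (F := restrict U F) (k := k) (X := TopCat.of U) (M := M)
    ((trivializes_restrict_iff (W := ⊤) _).2 (hc.res (extend_le U ⊤)))

theorem IsLocallyTrivial.isLocallyConstantSheaf {F : Shv k X} (h : IsLocallyTrivial F) :
    IsLocallyConstantSheaf F := h.exists_restrict_iso

end Restriction

/-! ### Locally constant sheaves are quasi-coherent -/

section Presentation

variable (k : Type u) [Ring k] (X : TopCat.{u})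

/-- The free module is a categorical coproduct, the form that the left adjoint `constSheaf` carries
to `freeSheaf`. -/
theorem exists_epi_free (M : ModuleCat.{u} k) :
    ∃ p : (∐ fun _ : M => ModuleCat.of k k) ⟶ M, Epi p := by
  let p : (∐ fun _ : M => ModuleCat.of k k) ⟶ M :=
    Sigma.desc fun m => ModuleCat.ofHom (LinearMap.toSpanSingleton k M m)
  refine ⟨p, (ModuleCat.epi_iff_surjective p).2 fun m => ?_⟩
  refine ⟨Sigma.ι (fun _ : M => ModuleCat.of k k) m (1 : k), ?_⟩
  have h := Sigma.ι_desc (fun m : M => ModuleCat.ofHom (LinearMap.toSpanSingleton k M m)) m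
  refine (congrArg (fun a => a.hom (1 : k)) h).trans ?_
  exact one_smul k m

theorem exists_presentation (M : ModuleCat.{u} k) :
    ∃ (I J : Type u) (f : (∐ fun _ : I => ModuleCat.of k k) ⟶ (∐ fun _ : J => ModuleCat.of k k))
      (g : (∐ fun _ : J => ModuleCat.of k k) ⟶ M) (w : f ≫ g = 0),
      (ShortComplex.mk f g w).Exact ∧ Epi g := by
  obtain ⟨g, hg⟩ := exists_epi_free k M
  obtain ⟨q, hq⟩ := exists_epi_free k (kernel g)
  refine ⟨_, _, q ≫ kernel.ι g, g, by simp, ?_, hg⟩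
  rw [ShortComplex.exact_iff_epi_kernel_lift]
  have : kernel.lift g (q ≫ kernel.ι g) (by simp) = q := by
    rw [← cancel_mono (kernel.ι g), kernel.lift_ι]
  change Epi (kernel.lift g (q ≫ kernel.ι g) _)
  rwa [this]

instance : (constSheaf k X).IsLeftAdjoint := (constSheafAdj k X).isLeftAdjoint

instance : (constSheaf k X).PreservesZeroMorphisms :=
  Functor.preservesZeroMorphisms_of_isLeftAdjoint _

/-- The constant sheaf functor commutes with direct sums. -/
noncomputable def constSheafFree (I : Type u) :
    (constSheaf k X).obj (∐ fun _ : I => ModuleCat.of k k) ≅ freeSheaf k X I :=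
  PreservesCoproduct.iso (constSheaf k X) _

variable {k X} in
-- Being a left adjoint, the constant sheaf functor preserves cokernels and coproducts, so it
-- carries a presentation of `M` to one of `F`.
theorem exists_presentation_of_iso {F : Shv k X} {M : ModuleCat.{u} k}
    (e : F ≅ (constSheaf k X).obj M) :
    ∃ (I J : Type u) (f : freeSheaf k X I ⟶ freeSheaf k X J) (g : freeSheaf k X J ⟶ F)
      (w : f ≫ g = 0), (ShortComplex.mk f g w).Exact ∧ Epi g := by
  obtain ⟨I, J, f, g, w, h, hg⟩ := exists_presentation k M
  have h1 := h.map_of_epi_of_preservesCokernel (constSheaf k X) hg inferInstance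
  have h2 : Epi ((constSheaf k X).map g) := inferInstance
  refine ⟨I, J, (constSheafFree k X I).inv ≫ (constSheaf k X).map f ≫ (constSheafFree k X J).hom,
    (constSheafFree k X J).inv ≫ (constSheaf k X).map g ≫ e.inv, ?_, ?_, ?_⟩
  · simp [← Functor.map_comp_assoc, w]
  · refine (ShortComplex.exact_iff_of_iso (ShortComplex.isoMk (constSheafFree k X I)
      (constSheafFree k X J) e.symm ?_ ?_)).1 h1
    · exact Iso.hom_inv_id_assoc _ _
    · exact Iso.hom_inv_id_assoc _ _
  · infer_instance

variable {k X} in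
theorem IsLocallyTrivial.isQuasicoherent {F : Shv k X} (h : IsLocallyTrivial F) :
    IsQuasicoherent k X F := by
  intro x
  obtain ⟨U, hx, M, ⟨e⟩⟩ := h.exists_restrict_iso x
  exact ⟨U, hx, exists_presentation_of_iso e⟩

end Presentation

/-! ### Quasi-coherent sheaves are locally constant -/

section Cokernel

variable {k : Type u} [Ring k] {X : TopCat.{u}}

/-- The map of sections of a trivialized sheaf over a connected open set is bijective. -/
theorem Trivializes.bijective_res {F : Shv k X} {U V : Opens X} {M : Type u} [AddCommGroup M]
    [Module k M] {c : M →ₗ[k] F.1.obj (op U)} (h : Trivializes c) (hV : V ≤ U)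
    (hVc : IsConnected (V : Set X)) : Function.Bijective (QuasiCoherator.res F hV ∘ₗ c) := by
  obtain ⟨x₀, hx₀⟩ := hVc.nonempty
  refine ⟨(injective_iff_map_eq_zero _).2 fun m hm => h.eq_zero V hV x₀ hx₀ m hm, fun s => ?_⟩
  have hg := (h.res hV).germ_bijective
  -- `d x` is the label of the germ of `s` at `x`; it is locally constant, hence constant on the
  -- connected set `V`.
  choose d hd using fun x : V => (hg x.1 x.2).2 (germ F V x.1 x.2 s)
  have hd' : IsLocallyConstant d := by
    rw [IsLocallyConstant.iff_exists_open]
    intro x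
    obtain ⟨W, hxW, hW, hW', e⟩ := exists_res_eq_res F x.2 x.2 _ _ (hd x)
    refine ⟨Subtype.val ⁻¹' (W : Set X), W.isOpen.preimage continuous_subtype_val, hxW,
      fun z hz => (hg z.1 z.2).1 ?_⟩
    refine (hd z).trans ?_
    rw [← germ_res F hW' z.1 hz s, ← e, germ_res]
  have : PreconnectedSpace V := Subtype.preconnectedSpace hVc.isPreconnected
  refine ⟨d ⟨x₀, hx₀⟩, section_ext F fun x hx => ?_⟩
  rw [← hd ⟨x, hx⟩, hd'.apply_eq_of_preconnectedSpace ⟨x₀, hx₀⟩ ⟨x, hx⟩]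

/-- Taking stalks is a left adjoint on sheaves, hence preserves cokernels. -/
theorem stalkMap_exact {A B F : Shv k X} (f : A ⟶ B) (g : B ⟶ F) (w : f ≫ g = 0)
    (h : (ShortComplex.mk f g w).Exact) (hg : Epi g) (x : X) :
    Function.Exact (stalkMap f x) (stalkMap g x) ∧ Function.Surjective (stalkMap g x) := by
  let G : Shv k X ⥤ ModuleCat.{u} k :=
    TopCat.Sheaf.forget (ModuleCat.{u} k) X ⋙ TopCat.Presheaf.stalkFunctor (ModuleCat.{u} k) x
  have hG : G.IsLeftAdjoint := inferInstanceAs (TopCat.Sheaf.forget (ModuleCat.{u} k) X ⋙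
    TopCat.Presheaf.stalkFunctor (ModuleCat.{u} k) x).IsLeftAdjoint
  have : G.PreservesZeroMorphisms := Functor.preservesZeroMorphisms_of_isLeftAdjoint _
  have h1 := h.map_of_epi_of_preservesCokernel G hg inferInstance
  have h2 : Epi (G.map g) := inferInstance
  exact ⟨(ShortComplex.ShortExact.moduleCat_exact_iff_function_exact _).1 h1,
    (ModuleCat.epi_iff_surjective _).1 h2⟩

/-- On a connected open set, the cokernel of a morphism of trivialized sheaves is trivialized. -/
theorem exists_trivializes_cokernel {A B F : Shv k X} (f : A ⟶ B) (g : B ⟶ F) (w : f ≫ g = 0)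
    (h : (ShortComplex.mk f g w).Exact) (hg : Epi g) {U V : Opens X} {M N : ModuleCat.{u} k}
    {a : M →ₗ[k] A.1.obj (op U)} {b : N →ₗ[k] B.1.obj (op U)} (ha : Trivializes a)
    (hb : Trivializes b) (hV : V ≤ U) (hVc : IsConnected (V : Set X)) :
    ∃ (Q : ModuleCat.{u} k) (c : Q →ₗ[k] F.1.obj (op V)), Trivializes c := by
  -- As `V` is connected, `B(V)` is `N`, so `f` is given over `V` by a single linear map `f₀ : M →
  -- N`. Right exactness on stalks shows that its cokernel trivializes `F`.
  let l := LinearEquiv.ofBijective _ (hb.bijective_res hV hVc)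
  let f₀ : M →ₗ[k] N := l.symm.toLinearMap ∘ₗ app f V ∘ₗ res A hV ∘ₗ a
  have hf₀ (m : M) : res B hV (b (f₀ m)) = app f V (res A hV (a m)) :=
    l.apply_symm_apply (app f V (res A hV (a m)))
  have hfg (s : A.1.obj (op V)) : app g V (app f V s) = 0 :=
    congrArg (fun (e : A ⟶ F) => app e V s) w
  refine ⟨ModuleCat.of k (N ⧸ LinearMap.range f₀),
    (LinearMap.range f₀).liftQ (app g V ∘ₗ res B hV ∘ₗ b) ?_, ?_⟩
  · rintro _ ⟨m, rfl⟩
    simp only [LinearMap.mem_ker, LinearMap.comp_apply, hf₀, hfg]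
  · refine Trivializes.of_germ_bijective fun x hx => ?_
    obtain ⟨hexact, hsurj⟩ := stalkMap_exact f g w h hg x
    have key (n : N) : germ F V x hx (app g V (res B hV (b n))) =
        stalkMap g x (germ B U x (hV hx) (b n)) := by
      rw [← stalkMap_germ, germ_res]
    constructor
    · refine (injective_iff_map_eq_zero (germ F V x hx ∘ₗ (LinearMap.range f₀).liftQ _ _)).2 ?_
      intro q hq
      obtain ⟨n, rfl⟩ := Submodule.Quotient.mk_surjective _ q
      refine (Submodule.Quotient.mk_eq_zero _).2 ?_
      obtain ⟨α, hα⟩ := (hexact _).1 ((key n).symm.trans hq)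
      obtain ⟨m, rfl⟩ := (ha.germ_bijective x (hV hx)).2 α
      refine ⟨m, (hb.germ_bijective x (hV hx)).1 ?_⟩
      refine Eq.trans ?_ hα
      change germ B U x (hV hx) (b (f₀ m)) = stalkMap f x (germ A U x (hV hx) (a m))
      rw [← germ_res B hV x hx, hf₀, ← germ_res A hV x hx, stalkMap_germ]
    · intro γ
      obtain ⟨β, rfl⟩ := hsurj γ
      obtain ⟨n, rfl⟩ := (hb.germ_bijective x (hV hx)).2 β
      exact ⟨Submodule.Quotient.mk n, key n⟩

theorem exists_trivializes_freeSheaf (k : Type u) [Ring k] (X : TopCat.{u}) (I : Type u) :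
    ∃ (M : ModuleCat.{u} k) (c : M →ₗ[k] (freeSheaf k X I).1.obj (op ⊤)), Trivializes c :=
  ⟨_, _, (trivializes_constSection X _).comp_app (constSheafFree k X I).hom
    (stalkMap_bijective_of_isIso _)⟩

/-- A space with a basis of simply connected open sets is locally connected. -/
theorem IsLocallySimplyConnected.exists_isConnected (hX : IsLocallySimplyConnected X) {x : X}
    {U : Opens X} (hx : x ∈ U) :
    ∃ V : Opens X, V ≤ U ∧ x ∈ V ∧ IsConnected (V : Set X) := by
  obtain ⟨V, hVU, hV, hxV, hVs⟩ := hX x U (U.isOpen.mem_nhds hx)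
  exact ⟨⟨V, hV⟩, hVU, hxV, isConnected_iff_connectedSpace.2 hVs.connectedSpace⟩

/-- Over the given `U` the map between free sheaves need not come from a linear map of modules; it
does after shrinking to a connected neighbourhood, where `exists_trivializes_cokernel` applies. -/
theorem IsQuasicoherent.isLocallyTrivial (hX : IsLocallySimplyConnected X) {F : Shv k X}
    (hF : IsQuasicoherent k X F) : IsLocallyTrivial F := by
  intro x
  obtain ⟨U, hx, I, J, f, g, w, h, hg⟩ := hF x
  obtain ⟨V, hVU, hxV, hVc⟩ := hX.exists_isConnected hx
  obtain ⟨M, a, ha⟩ := exists_trivializes_freeSheaf k (TopCat.of U) I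
  obtain ⟨N, b, hb⟩ := exists_trivializes_freeSheaf k (TopCat.of U) J
  have hVc' : IsConnected (trace U V : Set (TopCat.of U)) :=
    hVc.preimage_of_isOpenMap Subtype.val_injective U.isOpen.isOpenMap_subtype_val
      (by rw [Subtype.range_coe]; exact hVU)
  obtain ⟨Q, c, hc⟩ := exists_trivializes_cokernel f g w h hg ha hb (le_top : trace U V ≤ ⊤) hVc'
  exact ⟨extend U (trace U V), ⟨⟨x, hx⟩, hxV, rfl⟩, Q, c, (trivializes_restrict_iff c).1 hc⟩

end Cokernel

/-! ### Associated sheaves are locally constant -/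

section AssociatedSheafTrivial

variable {X Y : TopCat.{u}} (φ : Y ⟶ X) [IsUniversalCovering φ] [ConnectedSpace X]
  {k : Type u} [Ring k] (E : Rep.{u} k (Deck φ))

/-- Over the image of a set `V` on which `φ` is injective, the sections `φ z ↦ [z, e]` identify `E`
with every stalk. -/
theorem isLocallyTrivial_assocFunctor : IsLocallyTrivial ((assocFunctor φ k).obj E) := by
  intro x
  obtain ⟨y, rfl⟩ := surjective φ x
  obtain ⟨V, hyV, hV⟩ := exists_injOn φ y
  refine ⟨image φ V, mem_image_of_mem hyV, ModuleCat.of k E, localSection E V hV,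
    Trivializes.of_germ_bijective ?_⟩
  rintro _ ⟨z, hz, rfl⟩
  have h (e : E) := germ_localSection V hV e hz rfl (mem_image_of_mem hz)
  exact (funext h : (fun e => germ _ _ _ _ (localSection E V hV e)) = _) ▸
    stalkMk_bijective (E := E) z rfl

end AssociatedSheafTrivial

/-! ### Extension of germs on a simply connected space -/

section Monodromy

variable {k : Type u} [Ring k] {Y : TopCat.{u}}

/-- On a simply connected space, if every point has a neighbourhood to which all germs at its
points extend uniquely, then all germs extend uniquely to the whole space. -/
theorem germ_top_bijective (hY : IsSimplyConnected Y) (A : Shv k Y)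
    (hA : ∀ y, ∃ (V : Opens Y), y ∈ V ∧ ∀ z (hz : z ∈ V), Function.Bijective (germ A V z hz))
    (y₀ : Y) : Function.Bijective (germ A ⊤ y₀ trivial) := by
  have := hY.connectedSpace
  constructor
  · intro s t hst
    -- Identity principle: the set where two sections have equal germs is clopen, because on the
    -- given neighbourhoods one germ determines the section.
    let D : Set Y := {y | germ A ⊤ y trivial s = germ A ⊤ y trivial t}
    have key (y : Y) : ∃ V : Opens Y, y ∈ V ∧ ∀ z ∈ V, z ∈ D → ∀ w ∈ V, w ∈ D := by
      obtain ⟨V, hyV, hV⟩ := hA y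
      refine ⟨V, hyV, fun z hz hzD w hw => ?_⟩
      have h1 : res A (le_top : V ≤ ⊤) s = res A le_top t := (hV z hz).1 <| by
        rw [germ_res, germ_res]; exact hzD
      change germ A ⊤ w trivial s = germ A ⊤ w trivial t
      rw [← germ_res A le_top w hw s, h1, germ_res]
    have hD : IsClopen D := by
      refine ⟨isOpen_compl_iff.1 (isOpen_iff_mem_nhds.2 fun y hy => ?_),
        isOpen_iff_mem_nhds.2 fun y hy => ?_⟩
      · obtain ⟨V, hyV, hV⟩ := key y
        exact Filter.mem_of_superset (V.isOpen.mem_nhds hyV)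
          fun z hz hzD => hy (hV z hz hzD y hyV)
      · obtain ⟨V, hyV, hV⟩ := key y
        exact Filter.mem_of_superset (V.isOpen.mem_nhds hyV) fun z hz => hV y hyV hy z hz
    have huniv := hD.eq_univ ⟨y₀, hst⟩
    exact section_ext A fun y _ => (huniv ▸ Set.mem_univ y : y ∈ D)
  · intro a
    let P : TopCat.Presheaf (ModuleCat.{u} k) Y := A.1
    -- The hypothesis makes the étalé space a covering, which is trivial since the base is simply
    -- connected. The slice through the germ `a` is then a continuous global section `σ`.
    have hcov : IsCoveringMap (TopCat.Presheaf.EtaleSpace.base (F := P)) :=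
      TopCat.Presheaf.EtaleSpace.isCoveringMap_base hA
    obtain ⟨I, _, _, e, he⟩ := hY.exists_trivialization P.EtaleSpace _ hcov
    let σ : Y → P.EtaleSpace := fun y => e.symm (y, (e ⟨y₀, a⟩).2)
    have hσ : Continuous σ := by fun_prop
    have hσ' (y : Y) : ∃ b : Stalk A y, σ y = ⟨y, b⟩ := by
      have h1 : (σ y).base = y := by
        rw [← he (σ y)]
        simp [σ]
      generalize σ y = g at h1
      obtain ⟨z, b⟩ := g
      obtain rfl : z = y := h1
      exact ⟨b, rfl⟩
    choose b hb using hσ'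
    have hb₀ : b y₀ = a := by
      have h1 : σ y₀ = ⟨y₀, a⟩ := by
        have : (y₀, (e ⟨y₀, a⟩).2) = e ⟨y₀, a⟩ := Prod.ext (he ⟨y₀, a⟩).symm rfl
        simp only [σ, this, e.symm_apply_apply]
      rw [hb] at h1
      simpa using h1
    obtain ⟨s, hs⟩ := exists_section A (U := ⊤) (fun y _ => b y) (by
      intro y _
      obtain ⟨U, hyU, t, ht⟩ := TopCat.Presheaf.EtaleSpace.exists_section_of_tendsto (hσ.tendsto y)
      have key (z : Y) (g : P.EtaleSpace) (c : Stalk A z) (hg : g = ⟨z, c⟩)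
          (h : ∃ hz : g.base ∈ U, g.germ = P.germ U g.base hz t) :
          ∃ hz : z ∈ U, c = germ A U z hz t := by
        subst hg
        exact h
      obtain ⟨W, hW, hWo, hyW⟩ := eventually_nhds_iff.1 (ht.mono fun z => key z _ _ (hb z))
      have hWU : (⟨W, hWo⟩ : Opens Y) ≤ U := fun z hz => (hW z hz).1
      refine ⟨⟨W, hWo⟩, hyW, res A hWU t, fun z hz _ => ?_⟩
      rw [germ_res]
      exact (hW z hz).2.symm)
    exact ⟨s, (hs y₀ trivial).trans hb₀⟩

end Monodromy

/-! ### Recovering a locally constant sheaf from its sections on the covering -/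

section Counit

variable {X Y : TopCat.{u}} (φ : Y ⟶ X) {k : Type u} [Ring k] {F : Shv k X}

theorem Trivializes.unitApp {U : Opens X} {M : Type u} [AddCommGroup M] [Module k M]
    {c : M →ₗ[k] F.1.obj (op U)} (h : Trivializes c) :
    Trivializes ((QuasiCoherator.unitApp (φ := φ) F U).hom ∘ₗ c) :=
  of_germ_bijective fun y hy => by
    have h1 (m : M) := stalkEquiv_germ (φ := φ) F y rfl U hy hy (c m)
    exact (funext h1) ▸ (stalkEquiv φ F y rfl).bijective.comp (h.germ_bijective (φ y) hy)

/-- The total space of a universal covering of a locally simply connected space is locally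
connected. -/
theorem exists_isConnected_of_mem [IsUniversalCovering φ] (hX : IsLocallySimplyConnected X) {y : Y} {U : Opens Y}
    (hy : y ∈ U) : ∃ V : Opens Y, V ≤ U ∧ y ∈ V ∧ IsConnected (V : Set Y) := by
  have hφ : IsCoveringMap φ := IsUniversalCovering.isCoveringMap
  obtain ⟨V, hyV, hV⟩ := exists_injOn φ y
  obtain ⟨W, hW, hyW, hWc⟩ := hX.exists_isConnected
    (mem_image_of_mem (φ := φ) (V := V ⊓ U) ⟨hyV, hy⟩)
  -- On `V ⊓ U` the map `φ` is open and injective, so a connected open subset of the image has a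
  -- connected preimage.
  let f : (V ⊓ U : Opens Y) → X := fun z => φ z.1
  have hf : Function.Injective f := fun z w h => Subtype.ext (hV z.2.1 w.2.1 h)
  have hf' : IsOpenMap f := hφ.isOpenMap.comp (V ⊓ U).isOpen.isOpenMap_subtype_val
  have hc := hWc.preimage_of_isOpenMap hf hf' (by
    intro x hx
    obtain ⟨z, hz, rfl⟩ := hW hx
    exact ⟨⟨z, hz⟩, rfl⟩)
  refine ⟨extend (V ⊓ U) ⟨f ⁻¹' W, W.isOpen.preimage
    (hφ.continuous.comp continuous_subtype_val)⟩, ?_, ⟨⟨y, hyV, hy⟩, hyW, rfl⟩, ?_⟩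
  · exact (extend_le _ _).trans inf_le_right
  · exact hc.image _ continuous_subtype_val.continuousOn

variable [IsUniversalCovering φ]

/-- The sheaf `φ⁻¹ F` has the stalks of `F` and is locally trivial as well. Over small connected
open sets both its sections and its germs are the labels, so `germ_top_bijective` applies. -/
theorem IsLocallyTrivial.globalValue_bijective (hX : IsLocallySimplyConnected X)
    (hF : IsLocallyTrivial F) (y : Y) {x : X} (h : φ y = x) :
    Function.Bijective (globalValue (F := F) φ y h) := by
  refine (stalkEquiv φ F y h).symm.bijective.comp (germ_top_bijective
    (IsUniversalCovering.isSimplyConnected φ) ((pull φ k).obj F) (fun z => ?_) y)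
  obtain ⟨U, hzU, M, c, hc⟩ := hF (φ z)
  obtain ⟨V, hVU, hzV, hVc⟩ := exists_isConnected_of_mem φ hX (U := (Opens.map φ).obj U) hzU
  refine ⟨V, hzV, fun w hw => ?_⟩
  have h1 := (hc.unitApp φ).bijective_res hVU hVc
  have h2 := ((hc.unitApp φ).res hVU).germ_bijective w hw
  exact (Function.Bijective.of_comp_iff _ h1).1 h2

variable [ConnectedSpace X]

/-- A locally trivial sheaf `F` is isomorphic to `𝓛_E` with `E = Γ(Y, φ⁻¹ F)`. -/
theorem IsLocallyTrivial.nonempty_iso (hX : IsLocallySimplyConnected X)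
    (hF : IsLocallyTrivial F) :
    Nonempty ((assocFunctor φ k).obj ((sectionsRep φ k).obj F) ≅ F) := by
  -- The transpose of the identity, that is, the counit `[y, s] ↦ s(y)`; both `stalkMk` and
  -- `globalValue` are bijective, so it is bijective on stalks.
  obtain ⟨f, hf⟩ := exists_hom_stalkMk φ _ F (𝟙 ((sectionsRep φ k).obj F))
  have := isIso_of_stalkMap_bijective f fun x => by
    obtain ⟨y, rfl⟩ := surjective φ x
    have h1 := hF.globalValue_bijective φ hX y rfl
    have h2 := stalkMk_bijective (E := (sectionsRep φ k).obj F) y rfl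
    exact (Function.Bijective.of_comp_iff _ h2).1
      ((funext (hf y _ rfl) : stalkMap f (φ y) ∘ stalkMk y rfl = globalValue φ y rfl) ▸ h1)
  exact ⟨asIso f⟩

end Counit

end QuasiCoherator

/-! ### The equivalence and the quasi-coherator -/

theorem mainTheorem9 {k : Type u} [Ring k] {X Y : TopCat.{u}} [ConnectedSpace X]
    (hX : QuasiCoherator.IsLocallySimplyConnected X) (φ : Y ⟶ X)
    [QuasiCoherator.IsUniversalCovering φ] :
    ∃ h : ∀ E : Rep.{u} k (QuasiCoherator.Deck φ),
        QuasiCoherator.IsQuasicoherent k X ((QuasiCoherator.assocFunctor φ k).obj E),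
      (∀ E : Rep.{u} k (QuasiCoherator.Deck φ),
        QuasiCoherator.IsLocallyConstantSheaf ((QuasiCoherator.assocFunctor φ k).obj E)) ∧
      ((QuasiCoherator.IsQuasicoherent k X).lift
        (QuasiCoherator.assocFunctor φ k) h).IsEquivalence ∧
      (QuasiCoherator.incl k X).IsLeftAdjoint ∧
      ∀ Qc : QuasiCoherator.Shv k X ⥤ QuasiCoherator.Qcoh k X, (QuasiCoherator.incl k X ⊣ Qc) →
        Nonempty (Qc ≅ QuasiCoherator.sectionsRep φ k ⋙
          (QuasiCoherator.IsQuasicoherent k X).lift (QuasiCoherator.assocFunctor φ k) h) := by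
  have h (E : Rep.{u} k (QuasiCoherator.Deck φ)) :
      QuasiCoherator.IsQuasicoherent k X ((QuasiCoherator.assocFunctor φ k).obj E) :=
    (QuasiCoherator.isLocallyTrivial_assocFunctor φ E).isQuasicoherent
  let L := (QuasiCoherator.IsQuasicoherent k X).lift (QuasiCoherator.assocFunctor φ k) h
  have hff := QuasiCoherator.assocFullyFaithful φ k
  have := hff.full
  have := hff.faithful
  have hL : L.IsEquivalence :=
    { full := inferInstance
      faithful := inferInstance
      essSurj := ⟨fun F => by
        obtain ⟨i⟩ := (QuasiCoherator.IsQuasicoherent.isLocallyTrivial hX F.2).nonempty_iso φ hX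
        exact ⟨_, ⟨(QuasiCoherator.IsQuasicoherent k X).isoMk i⟩⟩⟩ }
  let e := L.asEquivalence
  -- The inclusion is the inverse equivalence followed by `E ↦ 𝓛_E`. Composing the adjunctions of
  -- these two functors gives it the right adjoint `F ↦ 𝓛_{Γ(Y, φ⁻¹ F)}`.
  let i : e.inverse ⋙ QuasiCoherator.assocFunctor φ k ≅ QuasiCoherator.incl k X :=
    Functor.isoWhiskerRight e.counitIso (QuasiCoherator.incl k X)
  let adj : QuasiCoherator.incl k X ⊣ QuasiCoherator.sectionsRep φ k ⋙ L :=
    (e.symm.toAdjunction.comp (QuasiCoherator.assocAdjunction φ k)).ofNatIsoLeft i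
  exact ⟨h, fun E => (QuasiCoherator.isLocallyTrivial_assocFunctor φ E).isLocallyConstantSheaf, hL,
    adj.isLeftAdjoint, fun Qc hQc => ⟨hQc.rightAdjointUniq adj⟩⟩
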